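/- For $B\ge 1$ and $\delta\in(0,1)$ let $d_{B;\delta}(e^{-x})$ be the minimum degree of a non-constant real polynomial $p$ with $\sup_{x\in[0,B]}|p(x)-e^{-x}|<\delta$. Let $G(x)=\sqrt{x^2+1}+x\log(\sqrt{x^2+1}-x)$ for $x\ge 0$. **Order of magnitude.** For every fixed $\delta_0<\tfrac12$, uniformly over all $B\ge1$ and $0<\delta\le\delta_0$, $$d_{B;\delta}(e^{-x})=\Theta\left(\max\left\{\sqrt{B\log(\delta^{-1})},\ \frac{\log(\delta^{-1})}{\log\max\{2,\,B^{-1}\log(\delta^{-1})\}}\right\}\right),$$ with implied constants depending only on $\delta_0$. Moreover, for every fixed $\rho>1$ the truncation at $2$ can be dropped, $$d_{B;\delta}(e^{-x})=\Theta\left(\max\left\{\sqrt{B\log(\delta^{-1})},\ \frac{\log(\delta^{-1})}{\log(B^{-1}\log(\delta^{-1}))}\right\}\right),$$ uniformly over those $B\ge 1$ and $0<\delta\le\delta_0$ for which $B^{-1}\log(\delta^{-1})\notin[1,\rho)$, with implied constants depending only on $\delta_0$ and $\rho$. **Leading constants.** As $B+\delta^{-1}\to\infty$ (with $B\ge1$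 and $\delta\in(0,1)$): 1. If $B=o(\log(\delta^{-1}))$, then $d_{B;\delta}(e^{-x})=\dfrac{\log(\delta^{-1})}{\log(B^{-1}\log(\delta^{-1}))}\,(1+o(1))$. 2. If $B=2r\log(\delta^{-1})$ for a fixed $r>0$, then $d_{B;\delta}(e^{-x})=(\nu r+o(1))\log(\delta^{-1})$, where $\nu=\nu(r)$ is the unique positive solution of $G(\nu)=1-r^{-1}$ (which exists). 3. If $B=\omega(\log(\delta^{-1}))$ and $B\le\delta^{-o(1)}$, then $d_{B;\delta}(e^{-x})=(1+o(1))\sqrt{B\log(\delta^{-1})}$. 4. If $B\ge\delta^{-a}$ for a fixed $a>0$, and $\delta\le\delta_0$ for a fixed $\delta_0<\tfrac12$, then $d_{B;\delta}(e^{-x})=\Theta\big(\sqrt{B\log(\delta^{-1})}\big)$, with implied constants depending only on $\delta_0$ (once $B+\delta^{-1}$ is large enough in terms of $a$ and $\delta_0$). -/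

import Mathlib

open Filter Topology Asymptotics

universe u

/-- The set of positive integers `n` such that some real polynomial of degree exactly `n`
(hence non-constant) satisfies `sup_{x ∈ [0, B]} |p x - f x| < δ`. -/
def approxDegreeSet (B δ : ℝ) (f : ℝ → ℝ) : Set ℕ :=
  {n | 0 < n ∧ ∃ p : Polynomial ℝ, p.natDegree = n ∧
    ∃ η : ℝ, η < δ ∧ ∀ x ∈ Set.Icc (0 : ℝ) B, |p.eval x - f x| ≤ η}

/-- `d_{B; δ}(f)`: the minimum degree of a non-constant polynomial that approximates `f`
on `[0, B]` with uniform error smaller than `δ`. -/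
noncomputable def approxDegree (B δ : ℝ) (f : ℝ → ℝ) : ℕ :=
  sInf (approxDegreeSet B δ f)

/-- `d_{B; δ}(e^{-x})`, as a real number. -/
noncomputable def expNegDegree (B δ : ℝ) : ℝ :=
  (approxDegree B δ (fun x => Real.exp (-x)) : ℝ)

/-- `G(x) = √(x² + 1) + x log(√(x² + 1) - x)`. -/
noncomputable def rateG (x : ℝ) : ℝ :=
  Real.sqrt (x ^ 2 + 1) + x * Real.log (Real.sqrt (x ^ 2 + 1) - x)

/-- A family of parameters `B ≥ 1`, `δ ∈ (0, 1)` along which `B + δ⁻¹` tends to infinity. -/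
structure IsParamFamily {ι : Type u} (l : Filter ι) (B δ : ι → ℝ) : Prop where
  one_le : ∀ i, 1 ≤ B i
  pos : ∀ i, 0 < δ i
  lt_one : ∀ i, δ i < 1
  tendsto : Tendsto (fun i => B i + (δ i)⁻¹) l atTop

/-! Put z = B/2, L = log(1/δ) and x = z(1 - cos θ). Polynomials of degree n on [0, B] become even
trigonometric polynomials of degree n, and e^{-x} becomes exp(z(cos θ - 1)) = E cos(kθ), where k is
the difference of two independent Poisson variables of mean z/2. The degree is therefore governed by
the tail of k. Its log-moment generating function is z(cosh t - 1), so P(k ≥ z sinh s) is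
exp(-zΦ(s)) to leading exponential order, with Φ = `legendreRate`. If s solves zΦ(s) = L, the degree
should be close to D = z sinh s.

Upper bound: truncating the Chebyshev series costs at most P(|k| > n), which Chernoff's inequality
controls (`exists_polynomial_approx_exp`, `expNegDegree_le`).

Lower bound: the functional `valleePoussinGap` kills degrees up to n, is at most 2Nη on functions
bounded by η, is nonnegative on every cosine and equals N - n on frequencies at least N. The weights
of the cosine expansion are nonnegative, so its value is at least (N - n) P(k ≥ N); Cramér's tilting
argument bounds this tail below (`skellamWeight.exp_le_of_hasSum_tail`, `le_expNegDegree`) and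
matches Chernoff as L → ∞. For bounded L one uses instead that exp(z(cos θ - 1)) is a spike of width
about 1/√z, which forces degree at least of order √B (`exists_sqrt_le_expNegDegree`).

The regimes then follow from one-variable asymptotics of Φ and sinh: s → ∞ when B = o(L), s is
constant when B = 2rL, and s → 0 when B = ω(L). The function G is 1 - Φ ∘ arsinh. -/

/-- The Legendre transform of `cosh - 1`, as a function of the dual variable `s`. -/
noncomputable def legendreRate (s : ℝ) : ℝ := 1 - Real.cosh s + s * Real.sinh s

/-! ### Elementary inequalities for the rate function. -/

namespace legendreRate

lemma sinh_le_mul_cosh {s : ℝ} (hs : 0 ≤ s) : Real.sinh s ≤ s * Real.cosh s := by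
  have hmono : MonotoneOn (fun x : ℝ => x * Real.cosh x - Real.sinh x) (Set.Ici 0) := by
    refine monotoneOn_of_hasDerivWithinAt_nonneg (convex_Ici 0)
      (f' := fun x => x * Real.sinh x) (by fun_prop) ?_ ?_
    · intro x _
      have h := ((hasDerivAt_id x).mul (Real.hasDerivAt_cosh x)).sub (Real.hasDerivAt_sinh x)
      refine (h.congr_deriv ?_).hasDerivWithinAt
      simp
    · intro x hx
      simp only [interior_Ici, Set.mem_Ioi] at hx
      exact mul_nonneg hx.le (Real.sinh_nonneg_iff.2 hx.le)
  have := hmono (Set.self_mem_Ici) (Set.mem_Ici.2 hs) hs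
  simp at this
  exact this

lemma mul_cosh_le {s : ℝ} (hs : 0 ≤ s) : s * Real.cosh s ≤ (1 + s) * Real.sinh s := by
  have h1 : Real.cosh s - Real.sinh s = Real.exp (-s) := Real.cosh_sub_sinh s
  have h2 : Real.exp (-s) ≤ 1 := Real.exp_le_one_iff.2 (by linarith)
  have h3 := Real.self_le_sinh_iff.2 hs
  nlinarith

lemma le_mul_sinh (s : ℝ) : legendreRate s ≤ s * Real.sinh s := by
  have := Real.one_le_cosh s
  unfold legendreRate
  linarith

/-- In half-angle form this is tanh u ≤ u at u = s/2. With `le_mul_sinh` it pins the rate to s sinh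
s up to a factor 2. -/
lemma half_mul_sinh_le {s : ℝ} (hs : 0 ≤ s) : s * Real.sinh s / 2 ≤ legendreRate s := by
  have h1 : Real.cosh s = 1 + 2 * Real.sinh (s / 2) ^ 2 := by
    have := Real.cosh_two_mul (s / 2)
    rw [Real.cosh_sq] at this
    rw [show s = 2 * (s / 2) by ring]
    rw [this]
    ring_nf
  have h2 : Real.sinh s = 2 * Real.sinh (s / 2) * Real.cosh (s / 2) := by
    rw [← Real.sinh_two_mul]
    ring_nf
  have h3 := sinh_le_mul_cosh (s := s / 2) (by linarith)
  have h4 : 0 ≤ Real.sinh (s / 2) := Real.sinh_nonneg_iff.2 (by linarith)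
  unfold legendreRate
  rw [h1, h2]
  nlinarith

lemma half_sq_le {s : ℝ} (hs : 0 ≤ s) : s ^ 2 / 2 ≤ legendreRate s := by
  have h1 := half_mul_sinh_le hs
  have h2 := Real.self_le_sinh_iff.2 hs
  nlinarith

lemma le_sinh_sq {s : ℝ} (hs : 0 ≤ s) : legendreRate s ≤ Real.sinh s ^ 2 := by
  have h1 := le_mul_sinh s
  have h2 := Real.self_le_sinh_iff.2 hs
  nlinarith

/-- Sharp as s → 0, where the right side is asymptotic to s²; `half_sq_le` is the matching lower
bound. -/
lemma two_mul_le {s : ℝ} (hs : 0 ≤ s) :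
    2 * legendreRate s ≤ s ^ 2 * (2 * Real.cosh s - 1) := by
  have h1 := sinh_le_mul_cosh hs
  have h2 : 1 + s ^ 2 / 2 ≤ Real.cosh s := by
    have h := Real.cosh_sq (s / 2)
    have h' := Real.cosh_two_mul (s / 2)
    rw [h, show 2 * (s / 2) = s by ring] at h'
    have h3 := Real.self_le_sinh_iff.2 (show 0 ≤ s / 2 by linarith)
    nlinarith
  unfold legendreRate
  nlinarith

/-- The tangent line inequality for `cosh`, i.e. Fenchel's inequality. -/
lemma mul_sinh_sub_le (s t : ℝ) : t * Real.sinh s - (Real.cosh t - 1) ≤ legendreRate s := by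
  have key : (t - s) * Real.sinh s ≤ (Real.cosh t - Real.cosh s) := by
    have hconv : ConvexOn ℝ Set.univ Real.cosh := by
      refine (MonotoneOn.convexOn_of_deriv convex_univ (by fun_prop) (by fun_prop) ?_)
      rw [Real.deriv_cosh]
      exact Real.sinh_strictMono.monotone.monotoneOn _
    rcases lt_trichotomy s t with h | h | h
    · have := hconv.deriv_le_slope (Set.mem_univ s) (Set.mem_univ t) h
        Real.differentiableAt_cosh
      rw [Real.deriv_cosh, slope_def_field, le_div_iff₀ (by linarith)] at this
      linarith
    · simp [h]
    · have := hconv.slope_le_deriv (Set.mem_univ t) (Set.mem_univ s) h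
        Real.differentiableAt_cosh
      rw [Real.deriv_cosh, slope_def_field, div_le_iff₀ (by linarith)] at this
      linarith
  unfold legendreRate
  linarith

/-- As a function of x = sinh s the rate is a Legendre transform, hence convex, and it vanishes at
0. Fenchel's inequality at s, scaled by κ, gives the claim directly. -/
lemma le_of_sinh_eq {s t κ : ℝ} (hκ0 : 0 ≤ κ) (hκ : κ ≤ 1) (h : Real.sinh t = κ * Real.sinh s) :
    legendreRate t ≤ κ * legendreRate s := by
  have h1 := Real.one_le_cosh t
  have h2 := mul_le_mul_of_nonneg_left (mul_sinh_sub_le s t) hκ0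
  unfold legendreRate at *
  rw [h]
  nlinarith

lemma continuous : Continuous legendreRate := by
  unfold legendreRate
  fun_prop

lemma strictMonoOn : StrictMonoOn legendreRate (Set.Ici 0) := by
  refine strictMonoOn_of_hasDerivWithinAt_pos (convex_Ici 0)
      (f' := fun x => x * Real.cosh x) continuous.continuousOn ?_ ?_
  · intro x _
    have h := ((hasDerivAt_const x (1 : ℝ)).sub (Real.hasDerivAt_cosh x)).add
      ((hasDerivAt_id x).mul (Real.hasDerivAt_sinh x))
    refine (h.congr_deriv ?_).hasDerivWithinAt
    simp
  · intro x hx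
    simp only [interior_Ici, Set.mem_Ioi] at hx
    exact mul_pos hx (Real.cosh_pos x)

@[simp] lemma zero : legendreRate 0 = 0 := by simp [legendreRate]

lemma exists_eq {u : ℝ} (hu : 0 < u) : ∃ s, 0 < s ∧ legendreRate s = u := by
  have h2 : u ≤ legendreRate (u + 2) := by
    have := half_sq_le (show 0 ≤ u + 2 by linarith)
    nlinarith
  obtain ⟨s, hs, hsu⟩ := intermediate_value_Icc (show 0 ≤ u + 2 by linarith)
    continuous.continuousOn (Set.mem_Icc.2 ⟨zero.le.trans hu.le, h2⟩)
  refine ⟨s, lt_of_le_of_ne hs.1 ?_, hsu⟩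
  rintro rfl
  simp at hsu
  exact hu.ne hsu

lemma pos {s : ℝ} (hs : 0 < s) : 0 < legendreRate s := by
  have := half_sq_le hs.le
  nlinarith

end legendreRate

lemma rateG_eq (x : ℝ) : rateG x = 1 - legendreRate (Real.arsinh x) := by
  have h1 : Real.log (Real.sqrt (x ^ 2 + 1) - x) = -Real.arsinh x := by
    rw [← Real.arsinh_neg, Real.arsinh]
    ring_nf
  unfold rateG legendreRate
  rw [h1, Real.cosh_arsinh, Real.sinh_arsinh, add_comm (1 : ℝ)]
  ring

/-! ### Size of the rate against sinh, uniformly and in the limits s → 0 and s → ∞. -/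

namespace legendreRate

lemma exp_div_two_le {s : ℝ} (hs : 2 ≤ s) : Real.exp s / 2 ≤ legendreRate s := by
  have h1 := Real.add_one_le_exp s
  have h2 : Real.exp (-s) * Real.exp s = 1 := by rw [← Real.exp_add]; simp
  have h3 := Real.exp_pos (-s)
  have h4 := Real.exp_pos s
  unfold legendreRate
  rw [Real.cosh_eq, Real.sinh_eq]
  have h5 : (s + 1) * Real.exp (-s) ≤ 1 := by nlinarith
  nlinarith

lemma le_mul_exp {s : ℝ} (hs : 0 ≤ s) : legendreRate s ≤ s * (Real.exp s / 2) := by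
  have h1 := le_mul_sinh s
  have h2 := Real.exp_pos (-s)
  rw [Real.sinh_eq] at h1
  nlinarith

lemma log_four_lt : Real.log 4 < 1.4 := by
  have := Real.log_two_lt_d9
  rw [show (4 : ℝ) = 2 ^ 2 by norm_num, Real.log_pow]
  push_cast
  linarith

lemma sub_log_le_log {s : ℝ} (hs : 2 ≤ s) : s - Real.log 4 ≤ Real.log (legendreRate s / 2) := by
  rw [← Real.log_exp s, ← Real.log_div (Real.exp_pos s).ne' (by norm_num)]
  have := exp_div_two_le hs
  rw [Real.log_exp]
  exact Real.log_le_log (by positivity) (by linarith)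

lemma log_le {s : ℝ} (hs : 0 < s) : Real.log (legendreRate s / 2) ≤ Real.log s + s := by
  rw [← Real.log_exp s, ← Real.log_mul (by rw [Real.log_exp]; exact hs.ne') (Real.exp_pos s).ne',
    Real.log_exp]
  have := le_mul_exp hs.le
  have h2 := pos hs
  have h3 := mul_pos hs (Real.exp_pos s)
  exact Real.log_le_log (by positivity) (by linarith)

lemma log_max_pos (v : ℝ) : 0 < Real.log (max 2 v) :=
  Real.log_pos (lt_of_lt_of_le one_lt_two (le_max_left _ _))

lemma div_eight_le_log {s : ℝ} : s / 8 ≤ Real.log (max 2 (legendreRate s / 2)) := by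
  have h2 := Real.log_two_gt_d9
  rcases le_or_gt s 4 with h | h
  · have : Real.log 2 ≤ Real.log (max 2 (legendreRate s / 2)) :=
      Real.log_le_log two_pos (le_max_left _ _)
    linarith
  · have h1 := sub_log_le_log (s := s) (by linarith)
    have h4 : Real.log (legendreRate s / 2) ≤ Real.log (max 2 (legendreRate s / 2)) :=
      Real.log_le_log (half_pos (pos (by linarith))) (le_max_right _ _)
    have := log_four_lt
    linarith

lemma log_le_two_mul {s : ℝ} (hs : 2 ≤ s) : Real.log (max 2 (legendreRate s / 2)) ≤ 2 * s := by
  rw [← Real.log_exp (2 * s)]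
  refine Real.log_le_log (by positivity) (max_le ?_ ?_)
  · have := Real.add_one_le_exp (2 * s)
    linarith
  · have h1 := le_mul_exp (show 0 ≤ s by linarith)
    have h2 := Real.add_one_le_exp s
    rw [two_mul, Real.exp_add]
    have h3 := Real.exp_pos s
    nlinarith

/-- With `sinh_le_max`, this is the order of magnitude of the degree divided by z: B⁻¹L is half the
rate. -/
lemma max_le_sinh {s : ℝ} (hs : 0 < s) :
    max (Real.sqrt (2 * legendreRate s))
      (legendreRate s / Real.log (max 2 (legendreRate s / 2))) ≤ 8 * Real.sinh s := by
  have h0 : 0 < Real.sinh s := Real.sinh_pos_iff.2 hs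
  refine max_le ?_ ?_
  · rw [Real.sqrt_le_left (by linarith)]
    have := le_sinh_sq hs.le
    nlinarith
  · rw [div_le_iff₀ (log_max_pos _)]
    have h1 := le_mul_sinh s
    have h2 := mul_le_mul_of_nonneg_left (div_eight_le_log (s := s)) h0.le
    linarith

lemma sinh_le_max {s : ℝ} (hs : 0 < s) :
    Real.sinh s ≤ 4 * max (Real.sqrt (2 * legendreRate s))
      (legendreRate s / Real.log (max 2 (legendreRate s / 2))) := by
  have h0 : 0 < Real.sinh s := Real.sinh_pos_iff.2 hs
  have h1 := half_mul_sinh_le hs.le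
  rcases le_or_gt s 2 with h | h
  · have hcosh : Real.cosh s ≤ 4 := by
      have h2 : Real.cosh s ≤ Real.cosh 2 := by
        rw [Real.cosh_le_cosh, abs_of_pos hs]; simpa using h
      have h3 : Real.exp 2 ≤ 7.4 := by
        have := Real.exp_one_lt_d9
        rw [show (2 : ℝ) = 1 + 1 by norm_num, Real.exp_add]
        have := Real.exp_pos 1
        nlinarith
      have h4 : Real.exp (-2) ≤ 0.5 := by
        have h5 : Real.exp (-2) * Real.exp 2 = 1 := by rw [← Real.exp_add]; simp
        have := Real.add_one_le_exp (2 : ℝ)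
        have := Real.exp_pos (-2)
        nlinarith
      rw [Real.cosh_eq] at h2
      rw [Real.cosh_eq 2] at h2
      rw [Real.cosh_eq]
      linarith
    have h2 := sinh_le_mul_cosh hs.le
    have h3 : Real.sinh s ≤ s * 4 := h2.trans (mul_le_mul_of_nonneg_left hcosh hs.le)
    have : Real.sinh s / 4 ≤ Real.sqrt (2 * legendreRate s) := by
      apply Real.le_sqrt_of_sq_le
      nlinarith
    have h4 := le_max_left (Real.sqrt (2 * legendreRate s))
      (legendreRate s / Real.log (max 2 (legendreRate s / 2)))
    linarith
  · have h2 : Real.sinh s / 4 ≤ legendreRate s / Real.log (max 2 (legendreRate s / 2)) := by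
      rw [le_div_iff₀ (log_max_pos _)]
      have := mul_le_mul_of_nonneg_left (log_le_two_mul h.le) h0.le
      linarith
    have h4 := le_max_right (Real.sqrt (2 * legendreRate s))
      (legendreRate s / Real.log (max 2 (legendreRate s / 2)))
    linarith

lemma tendsto_sinh_div_sqrt :
    Tendsto (fun s => Real.sinh s / Real.sqrt (2 * legendreRate s)) (𝓝[>] 0) (𝓝 1) := by
  have hlo : Tendsto (fun s => 1 / Real.sqrt (2 * Real.cosh s - 1)) (𝓝[>] (0 : ℝ)) (𝓝 1) := by
    have : ContinuousAt (fun s => 1 / Real.sqrt (2 * Real.cosh s - 1)) 0 := by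
      refine ContinuousAt.div (by fun_prop) (by fun_prop) ?_
      norm_num
    have h := this.tendsto.mono_left (nhdsWithin_le_nhds (s := Set.Ioi 0))
    norm_num at h ⊢
    exact h
  have hhi : Tendsto (fun s => Real.cosh s) (𝓝[>] (0 : ℝ)) (𝓝 1) := by
    have := Real.continuous_cosh.continuousAt.tendsto.mono_left
      (nhdsWithin_le_nhds (s := Set.Ioi 0) (a := (0 : ℝ)))
    simpa using this
  refine tendsto_of_tendsto_of_tendsto_of_le_of_le' hlo hhi ?_ ?_
  · filter_upwards [self_mem_nhdsWithin] with s hs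
    replace hs : 0 < s := hs
    have h1 := two_mul_le hs.le
    have h2 := Real.one_le_cosh s
    have h3 : Real.sqrt (2 * legendreRate s) ≤ s * Real.sqrt (2 * Real.cosh s - 1) := by
      refine (Real.sqrt_le_sqrt h1).trans ?_
      rw [Real.sqrt_mul (by positivity), Real.sqrt_sq hs.le]
    have h4 := pos hs
    rw [div_le_div_iff₀ (Real.sqrt_pos.2 (by linarith)) (Real.sqrt_pos.2 (by linarith)), one_mul]
    exact h3.trans (mul_le_mul_of_nonneg_right (Real.self_le_sinh_iff.2 hs.le) (Real.sqrt_nonneg _))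
  · filter_upwards [self_mem_nhdsWithin] with s hs
    replace hs : 0 < s := hs
    have h1 := half_sq_le hs.le
    have h4 := pos hs
    rw [div_le_iff₀ (Real.sqrt_pos.2 (by linarith))]
    have h3 : s ≤ Real.sqrt (2 * legendreRate s) := Real.le_sqrt_of_sq_le (by linarith)
    have h5 := sinh_le_mul_cosh hs.le
    have := mul_le_mul_of_nonneg_left h3 (Real.cosh_pos s).le
    linarith

lemma tendsto_mul_sinh_div :
    Tendsto (fun s => s * Real.sinh s / legendreRate s) atTop (𝓝 1) := by
  have h1 : Tendsto (fun s : ℝ => 1 - s⁻¹) atTop (𝓝 1) := by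
    simpa using tendsto_inv_atTop_zero.const_sub (1 : ℝ)
  have h2 : Tendsto (fun s => legendreRate s / (s * Real.sinh s)) atTop (𝓝 1) := by
    refine tendsto_of_tendsto_of_tendsto_of_le_of_le' h1 tendsto_const_nhds ?_ ?_
    · filter_upwards [eventually_gt_atTop 0] with s hs
      have h0 : 0 < Real.sinh s := Real.sinh_pos_iff.2 hs
      rw [le_div_iff₀ (by positivity)]
      have h3 : Real.cosh s - Real.sinh s = Real.exp (-s) := Real.cosh_sub_sinh s
      have h4 : Real.exp (-s) ≤ 1 := Real.exp_le_one_iff.2 (by linarith)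
      have : (1 - s⁻¹) * (s * Real.sinh s) = s * Real.sinh s - Real.sinh s := by
        field_simp
      rw [this]
      unfold legendreRate
      linarith
    · filter_upwards [eventually_gt_atTop 0] with s hs
      have h0 : 0 < Real.sinh s := Real.sinh_pos_iff.2 hs
      rw [div_le_iff₀ (by positivity)]
      linarith [le_mul_sinh s]
  simpa using h2.inv₀ one_ne_zero

lemma tendsto_log_div :
    Tendsto (fun s => Real.log (legendreRate s / 2) / s) atTop (𝓝 1) := by
  have h1 : Tendsto (fun s : ℝ => 1 - Real.log 4 * s⁻¹) atTop (𝓝 1) := by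
    simpa using (tendsto_inv_atTop_zero.const_mul (Real.log 4)).const_sub (1 : ℝ)
  have h2 : Tendsto (fun s : ℝ => Real.log s / s + 1) atTop (𝓝 1) := by
    simpa using (Real.isLittleO_log_id_atTop.tendsto_div_nhds_zero).add_const (1 : ℝ)
  refine tendsto_of_tendsto_of_tendsto_of_le_of_le' h1 h2 ?_ ?_
  · filter_upwards [eventually_ge_atTop 2] with s hs
    rw [le_div_iff₀ (by linarith), sub_mul, one_mul, mul_assoc,
      inv_mul_cancel₀ (by linarith), mul_one]
    exact sub_log_le_log hs
  · filter_upwards [eventually_gt_atTop 0] with s hs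
    rw [div_le_iff₀ hs, add_mul, div_mul_cancel₀ _ hs.ne', one_mul]
    exact log_le hs

lemma tendsto_sinh_mul_log_div :
    Tendsto (fun s => Real.sinh s * Real.log (legendreRate s / 2) / legendreRate s)
      atTop (𝓝 1) := by
  have := tendsto_mul_sinh_div.mul tendsto_log_div
  rw [one_mul] at this
  refine this.congr' ?_
  filter_upwards [eventually_gt_atTop 0] with s hs
  have := pos hs
  field_simp

end legendreRate

/-! ### Poisson differences: moments, tilting and the lower tail estimate. -/

/-- The joint law of two independent Poisson variables of mean `z / 2`. -/
noncomputable def skellamWeight (z : ℝ) (p : ℕ × ℕ) : ℝ :=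
  Real.exp (-z) * ((z / 2) ^ p.1 / p.1.factorial * ((z / 2) ^ p.2 / p.2.factorial))

namespace skellamWeight

lemma hasSum_prod {𝕜 : Type*} [RCLike 𝕜] {f g : ℕ → 𝕜} {a b : 𝕜} (hf : HasSum f a)
    (hg : HasSum g b) :
    HasSum (fun p : ℕ × ℕ => f p.1 * g p.2) (a * b) :=
  hf.mul hg (summable_mul_of_summable_norm hf.summable.norm hg.summable.norm)

lemma hasSum_pow_div_mul_pow_div (x y : ℂ) :
    HasSum (fun p : ℕ × ℕ => x ^ p.1 / p.1.factorial * (y ^ p.2 / p.2.factorial))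
      (Complex.exp x * Complex.exp y) := by
  have h : ∀ x : ℂ, HasSum (fun n : ℕ => x ^ n / n.factorial) (Complex.exp x) := fun x => by
    rw [Complex.exp_eq_exp_ℂ]
    exact NormedSpace.expSeries_div_hasSum_exp x
  exact hasSum_prod (f := fun n => x ^ n / n.factorial) (g := fun n => y ^ n / n.factorial)
    (h x) (h y)

/-- The moment generating function at a complex argument: real ζ yields exponential moments,
imaginary ζ the cosine expansion. -/
lemma hasSum_mul_cexp (z : ℝ) (ζ : ℂ) :
    HasSum (fun p : ℕ × ℕ => (skellamWeight z p : ℂ) * Complex.exp (ζ * ((p.1 : ℂ) - p.2)))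
      (Complex.exp (z * (Complex.cosh ζ - 1))) := by
  have h := (hasSum_pow_div_mul_pow_div ((z / 2) * Complex.exp ζ)
    ((z / 2) * Complex.exp (-ζ))).mul_left (Complex.exp (-z))
  have e : Complex.exp (-z) * (Complex.exp ((z / 2) * Complex.exp ζ) *
      Complex.exp ((z / 2) * Complex.exp (-ζ))) = Complex.exp (z * (Complex.cosh ζ - 1)) := by
    rw [← Complex.exp_add, ← Complex.exp_add, Complex.cosh]
    congr 1
    ring
  rw [e] at h
  refine h.congr_fun fun p => ?_
  have e2 : Complex.exp (ζ * ((p.1 : ℂ) - p.2)) = Complex.exp ζ ^ p.1 * Complex.exp (-ζ) ^ p.2 := by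
    rw [← Complex.exp_nat_mul, ← Complex.exp_nat_mul, ← Complex.exp_add]
    ring_nf
  rw [e2, skellamWeight]
  push_cast
  rw [mul_pow, mul_pow]
  ring

lemma hasSum_mul_exp (z s : ℝ) :
    HasSum (fun p : ℕ × ℕ => skellamWeight z p * Real.exp (s * ((p.1 : ℝ) - p.2)))
      (Real.exp (z * (Real.cosh s - 1))) := by
  have h := hasSum_mul_cexp z s
  rw [← Complex.hasSum_ofReal]
  push_cast
  exact h

lemma hasSum_mul_cos (z θ : ℝ) :
    HasSum (fun p : ℕ × ℕ => skellamWeight z p * Real.cos (((p.1 : ℝ) - p.2) * θ))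
      (Real.exp (z * (Real.cos θ - 1))) := by
  have h := Complex.hasSum_re (hasSum_mul_cexp z (θ * Complex.I))
  have e : Complex.exp (z * (Complex.cosh (θ * Complex.I) - 1)) =
      ((Real.exp (z * (Real.cos θ - 1)) : ℝ) : ℂ) := by
    rw [Complex.cosh_mul_I]
    push_cast
    rfl
  rw [e, Complex.ofReal_re] at h
  refine h.congr_fun fun p => ?_
  rw [Complex.re_ofReal_mul]
  congr 1
  have : (θ : ℂ) * Complex.I * ((p.1 : ℂ) - p.2) =
      ((((p.1 : ℝ) - p.2) * θ : ℝ) : ℂ) * Complex.I := by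
    push_cast
    ring
  rw [this, Complex.exp_ofReal_mul_I_re]

lemma hasSum (z : ℝ) : HasSum (skellamWeight z) 1 := by
  simpa using hasSum_mul_exp z 0

lemma nonneg {z : ℝ} (hz : 0 ≤ z) (p : ℕ × ℕ) : 0 ≤ skellamWeight z p := by
  unfold skellamWeight
  positivity

lemma hasSum_pow_div_factorial (x : ℝ) :
    HasSum (fun a : ℕ => x ^ a / a.factorial) (Real.exp x) := by
  rw [Real.exp_eq_exp_ℝ]
  exact NormedSpace.expSeries_div_hasSum_exp x

lemma hasSum_pow_div_factorial_mul (x : ℝ) :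
    HasSum (fun a : ℕ => x ^ a / a.factorial * a) (Real.exp x * x) := by
  have h : HasSum (fun a : ℕ => x ^ (a + 1) / (a + 1).factorial * ((a + 1 : ℕ) : ℝ))
      (Real.exp x * x) := by
    refine ((hasSum_pow_div_factorial x).mul_right x).congr_fun fun a => ?_
    rw [Nat.factorial_succ]
    push_cast
    field_simp
    ring
  simpa using HasSum.zero_add (f := fun a : ℕ => x ^ a / a.factorial * (a : ℝ)) h

lemma hasSum_pow_div_factorial_mul_mul (x : ℝ) :
    HasSum (fun a : ℕ => x ^ a / a.factorial * (a * (a - 1))) (Real.exp x * x * x) := by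
  have h : HasSum (fun a : ℕ => x ^ (a + 1) / (a + 1).factorial *
      (((a + 1 : ℕ) : ℝ) * (((a + 1 : ℕ) : ℝ) - 1))) (Real.exp x * x * x) := by
    refine ((hasSum_pow_div_factorial_mul x).mul_right x).congr_fun fun a => ?_
    rw [Nat.factorial_succ]
    push_cast
    field_simp
    ring
  simpa using HasSum.zero_add
    (f := fun a : ℕ => x ^ a / a.factorial * ((a : ℝ) * ((a : ℝ) - 1))) h

lemma hasSum_pow_div_factorial_mul_sub (x : ℝ) :
    HasSum (fun a : ℕ => x ^ a / a.factorial * ((a : ℝ) - x)) 0 := by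
  have h := (hasSum_pow_div_factorial_mul x).sub ((hasSum_pow_div_factorial x).mul_right x)
  rw [sub_self] at h
  exact h.congr_fun fun a => by ring

lemma hasSum_pow_div_factorial_mul_sub_sq (x : ℝ) :
    HasSum (fun a : ℕ => x ^ a / a.factorial * ((a : ℝ) - x) ^ 2) (Real.exp x * x) := by
  have h := ((hasSum_pow_div_factorial_mul_mul x).add
    ((hasSum_pow_div_factorial_mul x).mul_right (1 - 2 * x))).add
    ((hasSum_pow_div_factorial x).mul_right (x ^ 2))
  rw [show Real.exp x * x * x + Real.exp x * x * (1 - 2 * x) + Real.exp x * x ^ 2 =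
    Real.exp x * x by ring] at h
  exact h.congr_fun fun a => by ring

/-- After centring, the cross term sums to zero by independence, so the two variances add. -/
lemma hasSum_mul_sub_sub_sq (x y : ℝ) :
    HasSum (fun p : ℕ × ℕ => x ^ p.1 / p.1.factorial * (y ^ p.2 / p.2.factorial) *
      ((p.1 : ℝ) - p.2 - (x - y)) ^ 2) (Real.exp x * Real.exp y * (x + y)) := by
  have h := ((hasSum_prod (hasSum_pow_div_factorial_mul_sub_sq x)
    (hasSum_pow_div_factorial y)).add (hasSum_prod (hasSum_pow_div_factorial x)
    (hasSum_pow_div_factorial_mul_sub_sq y))).sub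
    ((hasSum_prod (hasSum_pow_div_factorial_mul_sub x)
      (hasSum_pow_div_factorial_mul_sub y)).mul_left 2)
  rw [show Real.exp x * x * Real.exp y + Real.exp x * (Real.exp y * y) - 2 * (0 * 0) =
    Real.exp x * Real.exp y * (x + y) by ring] at h
  exact h.congr_fun fun a => by ring

/-- Tilting changes the Poisson means to (z/2)e^s and (z/2)e^{-s}, with difference z sinh s and sum
z cosh s. -/
lemma mul_exp_eq (z s : ℝ) (p : ℕ × ℕ) :
    skellamWeight z p * Real.exp (s * ((p.1 : ℝ) - p.2)) =
      Real.exp (-z) * ((z / 2 * Real.exp s) ^ p.1 / p.1.factorial *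
        ((z / 2 * Real.exp (-s)) ^ p.2 / p.2.factorial)) := by
  have e2 : Real.exp (s * ((p.1 : ℝ) - p.2)) = Real.exp s ^ p.1 * Real.exp (-s) ^ p.2 := by
    rw [← Real.exp_nat_mul, ← Real.exp_nat_mul, ← Real.exp_add]
    ring_nf
  rw [e2, skellamWeight, mul_pow, mul_pow]
  ring

/-- The variance of the exponentially tilted law of the difference. -/
lemma hasSum_mul_exp_mul_sq (z s : ℝ) :
    HasSum (fun p : ℕ × ℕ => skellamWeight z p * Real.exp (s * ((p.1 : ℝ) - p.2)) *
      ((p.1 : ℝ) - p.2 - z * Real.sinh s) ^ 2)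
      (Real.exp (z * (Real.cosh s - 1)) * (z * Real.cosh s)) := by
  have h := (hasSum_mul_sub_sub_sq (z / 2 * Real.exp s) (z / 2 * Real.exp (-s))).mul_left
    (Real.exp (-z))
  have e : Real.exp (-z) * (Real.exp (z / 2 * Real.exp s) * Real.exp (z / 2 * Real.exp (-s)) *
      (z / 2 * Real.exp s + z / 2 * Real.exp (-s))) =
      Real.exp (z * (Real.cosh s - 1)) * (z * Real.cosh s) := by
    rw [← Real.exp_add, ← mul_assoc, ← Real.exp_add, Real.cosh_eq]
    congr 1
    · congr 1; ring
    · ring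
  rw [e] at h
  refine h.congr_fun fun p => ?_
  rw [mul_exp_eq, Real.sinh_eq]
  ring

/-- Cramér's lower bound for the upper tail, with the deviation controlled by Chebyshev's
inequality for the tilted law. -/
lemma exp_le_of_hasSum_tail {z s y T : ℝ} (hz : 0 < z) (hs : 0 ≤ s)
    (hy : y ≤ z * Real.sinh s - Real.sqrt (2 * (z * Real.cosh s)))
    (hT : HasSum (fun p : ℕ × ℕ => if y ≤ (p.1 : ℝ) - p.2 then skellamWeight z p else 0) T) :
    Real.exp (-(z * legendreRate s) - s * Real.sqrt (2 * (z * Real.cosh s))) / 2 ≤ T := by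
  set v := z * Real.cosh s with hv
  have hv0 : 0 < v := mul_pos hz (Real.cosh_pos s)
  set t := Real.sqrt (2 * v) with ht
  have ht2 : t ^ 2 = 2 * v := Real.sq_sqrt (by positivity)
  have ht0 : 0 ≤ t := Real.sqrt_nonneg _
  set A := Real.exp (z * (Real.cosh s - 1)) with hA
  -- Chebyshev at √2 standard deviations: 1 - (k - z sinh s)²/(2v) lies below the indicator of the
  -- window, and its tilted sum is A - A/2.
  have h1 := (hasSum_mul_exp z s).sub ((hasSum_mul_exp_mul_sq z s).div_const (2 * v))
  rw [show Real.exp (z * (Real.cosh s - 1)) - Real.exp (z * (Real.cosh s - 1)) *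
    (z * Real.cosh s) / (2 * v) = A / 2 by rw [← hv, ← hA]; field_simp; ring] at h1
  have h2 := hT.mul_left (Real.exp (s * (z * Real.sinh s + t)))
  have h3 : A / 2 ≤ Real.exp (s * (z * Real.sinh s + t)) * T := by
    refine hasSum_le (fun p => ?_) h1 h2
    have hw := nonneg hz.le p
    set k : ℝ := (p.1 : ℝ) - p.2
    have he := Real.exp_pos (s * k)
    have he' := Real.exp_pos (s * (z * Real.sinh s + t))
    have hq : skellamWeight z p * Real.exp (s * k) - skellamWeight z p * Real.exp (s * k) *
        (k - z * Real.sinh s) ^ 2 / (2 * v) = skellamWeight z p * Real.exp (s * k) *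
        (1 - (k - z * Real.sinh s) ^ 2 / t ^ 2) := by
      rw [ht2]; ring
    rw [hq]
    have hrhs : 0 ≤ Real.exp (s * (z * Real.sinh s + t)) *
        (if y ≤ k then skellamWeight z p else 0) := by
      split_ifs <;> positivity
    by_cases hk : |k - z * Real.sinh s| ≤ t
    · rw [abs_le] at hk
      rw [if_pos (by linarith)]
      have h4 : Real.exp (s * k) ≤ Real.exp (s * (z * Real.sinh s + t)) :=
        Real.exp_le_exp.2 (mul_le_mul_of_nonneg_left (by linarith) hs)
      have h5 : 1 - (k - z * Real.sinh s) ^ 2 / t ^ 2 ≤ 1 := by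
        have : 0 ≤ (k - z * Real.sinh s) ^ 2 / t ^ 2 := by positivity
        linarith
      calc _ ≤ skellamWeight z p * Real.exp (s * k) * 1 :=
            mul_le_mul_of_nonneg_left h5 (by positivity)
        _ ≤ _ := by
          rw [mul_one, mul_comm]
          exact mul_le_mul_of_nonneg_right h4 hw
    · refine le_trans (mul_nonpos_of_nonneg_of_nonpos (by positivity) ?_) hrhs
      have h6 : 1 ≤ (k - z * Real.sinh s) ^ 2 / t ^ 2 := by
        rw [le_div_iff₀ (by rw [ht2]; positivity), one_mul, sq_le_sq, abs_of_nonneg ht0]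
        linarith
      linarith
  have h4 : Real.exp (-(z * legendreRate s) - s * t) =
      A * Real.exp (-(s * (z * Real.sinh s + t))) := by
    rw [hA, ← Real.exp_add, legendreRate]
    congr 1
    ring
  rw [h4]
  have h5 : Real.exp (-(s * (z * Real.sinh s + t))) * Real.exp (s * (z * Real.sinh s + t)) = 1 := by
    rw [← Real.exp_add]; simp
  have h6 := mul_le_mul_of_nonneg_left h3 (Real.exp_pos (-(s * (z * Real.sinh s + t)))).le
  rw [← mul_assoc, h5] at h6
  linarith

end skellamWeight

/-! ### Fejér kernels and their Fourier coefficients. -/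

open Real in
lemma integral_cos_int_mul (j : ℤ) :
    ∫ θ in (-π)..π, cos (j * θ) = if j = 0 then 2 * π else 0 := by
  split_ifs with h
  · subst h
    simp
    ring
  · have h' : (j : ℝ) ≠ 0 := by exact_mod_cast h
    rw [intervalIntegral.integral_comp_mul_left (fun x => cos x) h', integral_cos]
    have : sin (j * π) = 0 := sin_int_mul_pi j
    rw [mul_neg, sin_neg, this]
    simp

/-- The sum of the first `N` Dirichlet kernels, i.e. `N` times the Fejér kernel. -/
noncomputable def fejerSum (N : ℕ) (θ : ℝ) : ℝ :=
  ∑ m ∈ Finset.range N, (1 + 2 * ∑ k ∈ Finset.range m, Real.cos ((k + 1) * θ))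

namespace fejerSum

open Real

/-- The right side is |∑ e^{ijθ}|². Adjoining the term e^{iNθ} raises it by 1 + 2 ∑ cos(kθ) over 1 ≤
k ≤ N, the next Dirichlet kernel. -/
lemma eq_sq_add_sq (N : ℕ) (θ : ℝ) :
    fejerSum N θ = (∑ j ∈ Finset.range N, cos (j * θ)) ^ 2 +
      (∑ j ∈ Finset.range N, sin (j * θ)) ^ 2 := by
  induction N with
  | zero => simp [fejerSum]
  | succ N ih =>
    have h1 : fejerSum (N + 1) θ =
        fejerSum N θ + (1 + 2 * ∑ k ∈ Finset.range N, cos ((k + 1) * θ)) := by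
      rw [fejerSum, Finset.sum_range_succ, fejerSum]
    have h2 : ∑ k ∈ Finset.range N, cos (((k : ℝ) + 1) * θ) =
        (∑ j ∈ Finset.range N, cos (j * θ)) * cos (N * θ) +
        (∑ j ∈ Finset.range N, sin (j * θ)) * sin (N * θ) := by
      rw [← Finset.sum_range_reflect, Finset.sum_mul, Finset.sum_mul, ← Finset.sum_add_distrib]
      refine Finset.sum_congr rfl fun j hj => ?_
      have hj' := Finset.mem_range.1 hj
      have : ((N - 1 - j : ℕ) : ℝ) + 1 = (N : ℝ) - j := by
        rw [eq_sub_iff_add_eq]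
        norm_cast
        omega
      rw [this, sub_mul, cos_sub]
      ring
    rw [h1, ih, h2, Finset.sum_range_succ, Finset.sum_range_succ]
    linear_combination -(sin_sq_add_cos_sq (N * θ))

lemma nonneg (N : ℕ) (θ : ℝ) : 0 ≤ fejerSum N θ := by
  rw [eq_sq_add_sq]
  positivity

lemma le_sq (N : ℕ) (θ : ℝ) : fejerSum N θ ≤ (N : ℝ) ^ 2 := by
  have h : ∀ m ∈ Finset.range N, (1 + 2 * ∑ k ∈ Finset.range m, cos (((k : ℝ) + 1) * θ)) ≤
      2 * (m : ℝ) + 1 := by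
    intro m _
    have : ∑ k ∈ Finset.range m, cos (((k : ℝ) + 1) * θ) ≤ ∑ k ∈ Finset.range m, (1 : ℝ) :=
      Finset.sum_le_sum fun k _ => cos_le_one _
    simp at this
    linarith
  refine (Finset.sum_le_sum h).trans (le_of_eq ?_)
  induction N with
  | zero => simp
  | succ N ih =>
    rw [Finset.sum_range_succ, ih]
    · push_cast
      ring
    · intro m hm
      exact h m (Finset.mem_range.2 ((Finset.mem_range.1 hm).trans (Nat.lt_succ_self N)))

lemma continuous (N : ℕ) : Continuous (fejerSum N) := by
  unfold fejerSum
  fun_prop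

lemma integral_cos_mul_dirichlet (j : ℤ) (m : ℕ) :
    ∫ θ in (-π)..π, cos (j * θ) * (1 + 2 * ∑ k ∈ Finset.range m, cos (((k : ℝ) + 1) * θ)) =
      if j.natAbs ≤ m then 2 * π else 0 := by
  induction m with
  | zero =>
    simp only [Finset.range_zero, Finset.sum_empty, mul_zero, add_zero, mul_one]
    rw [integral_cos_int_mul]
    simp
  | succ m ih =>
    have h : ∀ θ : ℝ,
        cos (j * θ) * (1 + 2 * ∑ k ∈ Finset.range (m + 1), cos (((k : ℝ) + 1) * θ)) =
        cos (j * θ) * (1 + 2 * ∑ k ∈ Finset.range m, cos (((k : ℝ) + 1) * θ)) +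
        (cos ((j - (m + 1) : ℤ) * θ) + cos ((j + (m + 1) : ℤ) * θ)) := by
      intro θ
      rw [Finset.sum_range_succ]
      push_cast
      rw [sub_mul, add_mul (j : ℝ), cos_sub, cos_add]
      ring
    simp_rw [h]
    rw [intervalIntegral.integral_add (Continuous.intervalIntegrable (by fun_prop) _ _)
      (Continuous.intervalIntegrable (by fun_prop) _ _),
      intervalIntegral.integral_add (Continuous.intervalIntegrable (by fun_prop) _ _)
      (Continuous.intervalIntegrable (by fun_prop) _ _), ih, integral_cos_int_mul,
      integral_cos_int_mul]
    split_ifs <;> first | omega | simp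

/-- Truncated subtraction serves as the positive part: the coefficients form a triangle. -/
lemma integral_cos_mul (j : ℤ) (N : ℕ) :
    ∫ θ in (-π)..π, cos (j * θ) * fejerSum N θ = 2 * π * ((N - j.natAbs : ℕ) : ℝ) := by
  induction N with
  | zero => simp [fejerSum]
  | succ N ih =>
    have h : ∀ θ, cos (j * θ) * fejerSum (N + 1) θ = cos (j * θ) * fejerSum N θ +
        cos (j * θ) * (1 + 2 * ∑ k ∈ Finset.range N, cos (((k : ℝ) + 1) * θ)) := fun θ => by
      rw [fejerSum, Finset.sum_range_succ, fejerSum, mul_add]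
    have hc := continuous N
    simp_rw [h]
    rw [intervalIntegral.integral_add (Continuous.intervalIntegrable (by fun_prop) _ _)
      (Continuous.intervalIntegrable (by fun_prop) _ _), ih, integral_cos_mul_dirichlet]
    split_ifs with hj
    · rw [Nat.succ_sub hj]
      push_cast
      ring
    · rw [show N + 1 - j.natAbs = N - j.natAbs by omega]
      ring

lemma integral_eq (N : ℕ) : ∫ θ in (-π)..π, fejerSum N θ = 2 * π * N := by
  simpa using integral_cos_mul 0 N

end fejerSum

/-! ### The de la Vallée-Poussin functional. -/

open Real in
/-- `N - n` times the difference between the value at `0` and the mean against the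
de la Vallée-Poussin kernel with parameters `n < N`. -/
noncomputable def valleePoussinGap (n N : ℕ) (g : ℝ → ℝ) : ℝ :=
  ((N : ℝ) - n) * g 0 - (∫ θ in (-π)..π, g θ * (fejerSum N θ - fejerSum n θ)) / (2 * π)

namespace valleePoussinGap

open Real

lemma continuous_kernel (n N : ℕ) : Continuous fun θ => fejerSum N θ - fejerSum n θ :=
  (fejerSum.continuous N).sub (fejerSum.continuous n)

/-- For n ≤ N the subtracted bracket is a trapezoid in |j|: N - n up to n, then linear down to 0 at
N. -/
lemma map_cos (n N : ℕ) (j : ℤ) :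
    valleePoussinGap n N (fun θ => cos (j * θ)) =
      ((N : ℝ) - n) - (((N - j.natAbs : ℕ) : ℝ) - ((n - j.natAbs : ℕ) : ℝ)) := by
  have hN := fejerSum.continuous N
  have hn := fejerSum.continuous n
  have hpi := pi_ne_zero
  unfold valleePoussinGap
  simp_rw [mul_sub]
  rw [intervalIntegral.integral_sub (Continuous.intervalIntegrable (by fun_prop) _ _)
      (Continuous.intervalIntegrable (by fun_prop) _ _), fejerSum.integral_cos_mul,
      fejerSum.integral_cos_mul]
  simp only [mul_zero, cos_zero]
  field_simp

lemma map_cos_of_le {n N : ℕ} (hN : n ≤ N) {j : ℤ} (hj : j.natAbs ≤ n) :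
    valleePoussinGap n N (fun θ => cos (j * θ)) = 0 := by
  rw [map_cos, Nat.cast_sub hj, Nat.cast_sub (hj.trans hN)]
  ring

lemma map_cos_nonneg {n N : ℕ} (hN : n ≤ N) (j : ℤ) :
    0 ≤ valleePoussinGap n N (fun θ => cos (j * θ)) := by
  rw [map_cos, sub_nonneg, sub_le_sub_iff]
  norm_cast
  omega

lemma map_cos_of_ge {n N : ℕ} (hN : n ≤ N) {j : ℤ} (hj : N ≤ j.natAbs) :
    valleePoussinGap n N (fun θ => cos (j * θ)) = (N : ℝ) - n := by
  rw [map_cos, Nat.sub_eq_zero_of_le hj, Nat.sub_eq_zero_of_le (hN.trans hj)]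
  simp

lemma map_sub {n N : ℕ} {g h : ℝ → ℝ} (hg : Continuous g) (hh : Continuous h) :
    valleePoussinGap n N (fun θ => g θ - h θ) =
      valleePoussinGap n N g - valleePoussinGap n N h := by
  have hk := continuous_kernel n N
  unfold valleePoussinGap
  simp_rw [sub_mul (g _)]
  rw [intervalIntegral.integral_sub (Continuous.intervalIntegrable (by fun_prop) _ _)
      (Continuous.intervalIntegrable (by fun_prop) _ _)]
  ring

lemma map_const_mul (n N : ℕ) (c : ℝ) (g : ℝ → ℝ) :
    valleePoussinGap n N (fun θ => c * g θ) = c * valleePoussinGap n N g := by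
  unfold valleePoussinGap
  simp_rw [mul_assoc c]
  rw [intervalIntegral.integral_const_mul]
  ring

lemma map_sum {ι : Type*} (n N : ℕ) (s : Finset ι) {g : ι → ℝ → ℝ}
    (hg : ∀ i, Continuous (g i)) :
    valleePoussinGap n N (fun θ => ∑ i ∈ s, g i θ) = ∑ i ∈ s, valleePoussinGap n N (g i) := by
  have hk := continuous_kernel n N
  unfold valleePoussinGap
  simp_rw [Finset.sum_mul]
  rw [intervalIntegral.integral_finsetSum
    fun i _ => Continuous.intervalIntegrable (u := fun θ => g i θ * _) ((hg i).mul hk) _ _,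
    Finset.sum_sub_distrib, Finset.mul_sum, Finset.sum_div]

/-- The constant is (N - n) + (N + n): the point value plus the masses of the two nonnegative Fejér
sums. -/
lemma le_of_abs_le {n N : ℕ} {g : ℝ → ℝ} {η : ℝ} (hN : n ≤ N)
    (hg : Continuous g) (hη : ∀ θ, |g θ| ≤ η) : valleePoussinGap n N g ≤ 2 * N * η := by
  have hN' := fejerSum.continuous N
  have hn' := fejerSum.continuous n
  have hpi := pi_pos
  have h1 : -(∫ θ in (-π)..π, η * (fejerSum N θ + fejerSum n θ)) ≤
      ∫ θ in (-π)..π, g θ * (fejerSum N θ - fejerSum n θ) := by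
    rw [← intervalIntegral.integral_neg]
    refine intervalIntegral.integral_mono_on (by linarith)
      (Continuous.intervalIntegrable (by fun_prop) _ _)
      (Continuous.intervalIntegrable (by fun_prop) _ _) fun θ _ => ?_
    have ha := fejerSum.nonneg N θ
    have hb := fejerSum.nonneg n θ
    have hc := abs_le.1 (hη θ)
    nlinarith
  rw [intervalIntegral.integral_const_mul, intervalIntegral.integral_add
    (hN'.intervalIntegrable _ _) (hn'.intervalIntegrable _ _), fejerSum.integral_eq,
    fejerSum.integral_eq] at h1
  have h2 : -(η * (N + n)) ≤
      (∫ θ in (-π)..π, g θ * (fejerSum N θ - fejerSum n θ)) / (2 * π) := by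
    rw [le_div_iff₀ (by positivity)]
    linarith
  have h3 : ((N : ℝ) - n) * g 0 ≤ ((N : ℝ) - n) * η :=
    mul_le_mul_of_nonneg_left ((le_abs_self _).trans (hη 0)) (by simpa using hN)
  unfold valleePoussinGap
  linarith

/-- Useful for a spike at 0, whose mean is small: the kernel is at most N² everywhere. -/
lemma ge_of_nonneg {n N : ℕ} {g : ℝ → ℝ} (hg : Continuous g) (h0 : ∀ θ, 0 ≤ g θ) :
    ((N : ℝ) - n) * g 0 - (N : ℝ) ^ 2 * (∫ θ in (-π)..π, g θ) / (2 * π) ≤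
      valleePoussinGap n N g := by
  have hN' := fejerSum.continuous N
  have hn' := fejerSum.continuous n
  have hpi := pi_pos
  have h1 : ∫ θ in (-π)..π, g θ * (fejerSum N θ - fejerSum n θ) ≤
      ∫ θ in (-π)..π, (N : ℝ) ^ 2 * g θ := by
    refine intervalIntegral.integral_mono_on (by linarith)
      (Continuous.intervalIntegrable (by fun_prop) _ _)
      (Continuous.intervalIntegrable (by fun_prop) _ _) fun θ _ => ?_
    rw [mul_comm]
    exact mul_le_mul_of_nonneg_right
      (by linarith [fejerSum.nonneg n θ, fejerSum.le_sq N θ]) (h0 θ)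
  rw [intervalIntegral.integral_const_mul] at h1
  unfold valleePoussinGap
  have := div_le_div_of_nonneg_right h1 (show 0 ≤ 2 * π by positivity)
  linarith

lemma hasSum_of_cos {ι : Type*} [Countable ι] (n N : ℕ) {w : ι → ℝ} {k : ι → ℤ} {f : ℝ → ℝ}
    (hw : Summable w) (hw0 : ∀ i, 0 ≤ w i)
    (hf : ∀ θ, HasSum (fun i => w i * cos (k i * θ)) (f θ)) :
    HasSum (fun i => w i * valleePoussinGap n N (fun θ => cos (k i * θ)))
      (valleePoussinGap n N f) := by
  have hk := continuous_kernel n N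
  have hI : HasSum (fun i => ∫ θ in (-π)..π, w i * cos (k i * θ) * (fejerSum N θ - fejerSum n θ))
      (∫ θ in (-π)..π, f θ * (fejerSum N θ - fejerSum n θ)) := by
    refine intervalIntegral.hasSum_integral_of_dominated_convergence
      (fun i θ => w i * |fejerSum N θ - fejerSum n θ|) (fun i => ?_) (fun i => ?_) ?_ ?_ ?_
    · exact Continuous.aestronglyMeasurable (by fun_prop)
    · refine MeasureTheory.ae_of_all _ fun θ _ => ?_
      rw [norm_mul, norm_mul, norm_eq_abs, norm_eq_abs, norm_eq_abs, abs_of_nonneg (hw0 i)]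
      exact mul_le_mul_of_nonneg_right
        (mul_le_of_le_one_right (hw0 i) (abs_cos_le_one _)) (abs_nonneg _)
    · exact MeasureTheory.ae_of_all _ fun θ _ => hw.mul_right _
    · simp_rw [tsum_mul_right]
      exact Continuous.intervalIntegrable (by fun_prop) _ _
    · exact MeasureTheory.ae_of_all _ fun θ _ => (hf θ).mul_right _
  have h0 := (hf 0).mul_left ((N : ℝ) - n)
  refine (h0.sub (hI.div_const (2 * π))).congr_fun fun i => ?_
  rw [← map_const_mul]
  rfl

end valleePoussinGap

/-! ### Duality with polynomials in cos θ, and lower bounds for the gap of the exponential. -/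

/-- A polynomial of degree at most `n` in `cos θ` is an even trigonometric polynomial. -/
lemma exists_eval_cos_eq_sum (n : ℕ) (P : Polynomial ℝ) (hP : P.natDegree ≤ n) :
    ∃ c : ℕ → ℝ, ∀ θ, P.eval (Real.cos θ) =
      ∑ k ∈ Finset.range (n + 1), c k * Real.cos (((k : ℕ) : ℤ) * θ) := by
  induction n generalizing P with
  | zero =>
    refine ⟨fun _ => P.coeff 0, fun θ => ?_⟩
    rw [Polynomial.eq_C_of_natDegree_le_zero hP]
    simp
  | succ n ih =>
    set T := Polynomial.Chebyshev.T ℝ ((n + 1 : ℕ) : ℤ) with hT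
    have hdeg : T.natDegree = n + 1 := by
      rw [hT, Polynomial.Chebyshev.natDegree_T]; rfl
    have hlead : T.coeff (n + 1) ≠ 0 := by
      rw [← hdeg, Polynomial.coeff_natDegree, Polynomial.leadingCoeff_ne_zero]
      intro h
      rw [h] at hdeg
      simp at hdeg
    -- Subtracting this multiple of the Chebyshev polynomial cancels the top coefficient and lowers
    -- the degree.
    set a := P.coeff (n + 1) / T.coeff (n + 1) with ha
    obtain ⟨c, hc⟩ := ih (P - Polynomial.C a * T) (by
      rw [Polynomial.natDegree_le_iff_coeff_eq_zero]
      intro m hm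
      rcases (Nat.succ_le_of_lt hm).eq_or_lt with h | h
      · rw [← h, Polynomial.coeff_sub, Polynomial.coeff_C_mul, ha]
        field_simp
        simp
      · rw [Polynomial.coeff_sub, Polynomial.coeff_C_mul,
          Polynomial.coeff_eq_zero_of_natDegree_lt (hP.trans_lt h),
          Polynomial.coeff_eq_zero_of_natDegree_lt (hdeg.trans_lt h)]
        simp)
    refine ⟨fun k => if k = n + 1 then a else c k, fun θ => ?_⟩
    rw [Finset.sum_range_succ]
    have h1 : ∑ k ∈ Finset.range (n + 1), (if k = n + 1 then a else c k) *
        Real.cos (((k : ℕ) : ℤ) * θ) =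
        ∑ k ∈ Finset.range (n + 1), c k * Real.cos (((k : ℕ) : ℤ) * θ) := by
      refine Finset.sum_congr rfl fun k hk => ?_
      rw [if_neg (Finset.mem_range.1 hk).ne]
    simp only [if_true]
    rw [h1, ← hc θ, Polynomial.eval_sub, Polynomial.eval_mul, Polynomial.eval_C,
      hT, Polynomial.Chebyshev.T_real_cos]
    ring

lemma valleePoussinGap.map_eval_cos {n N : ℕ} (hN : n ≤ N) {P : Polynomial ℝ}
    (hP : P.natDegree ≤ n) : valleePoussinGap n N (fun θ => P.eval (Real.cos θ)) = 0 := by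
  obtain ⟨c, hc⟩ := exists_eval_cos_eq_sum n P hP
  simp_rw [hc]
  rw [map_sum n N _ fun k => by fun_prop]
  refine Finset.sum_eq_zero fun k hk => ?_
  rw [map_const_mul, map_cos_of_le hN, mul_zero]
  have := Finset.mem_range.1 hk
  simp
  omega

/-- Any function within `η` of a polynomial of degree at most `n` in `cos θ` has a small gap. -/
lemma valleePoussinGap.le_of_approx {n N : ℕ} (hN : n ≤ N) {P : Polynomial ℝ}
    (hP : P.natDegree ≤ n) {f : ℝ → ℝ} (hf : Continuous f) {η : ℝ}
    (h : ∀ θ, |P.eval (Real.cos θ) - f θ| ≤ η) : valleePoussinGap n N f ≤ 2 * N * η := by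
  have hc : Continuous fun θ => P.eval (Real.cos θ) := P.continuous.comp Real.continuous_cos
  have h1 := le_of_abs_le hN (hf.sub hc) (η := η) fun θ => by
    rw [Pi.sub_apply, abs_sub_comm]
    exact h θ
  have h2 := map_sub (n := n) (N := N) hf hc
  rw [map_eval_cos hN hP, sub_zero] at h2
  linarith [h2 ▸ h1]

open Real in
-- On [-π, π] one has 1 - cos θ ≥ 2θ²/π², so a Gaussian integral dominates.
lemma integral_exp_mul_cos_sub_one_le {z : ℝ} (hz : 0 < z) :
    (∫ θ in (-π)..π, exp (z * (cos θ - 1))) / (2 * π) ≤ 1 / √z := by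
  have hpi := pi_pos
  have hb : 0 < 2 / π ^ 2 * z := by positivity
  have h1 : ∫ θ in (-π)..π, exp (z * (cos θ - 1)) ≤
      ∫ θ in (-π)..π, exp (-(2 / π ^ 2 * z) * θ ^ 2) := by
    refine intervalIntegral.integral_mono_on (by linarith)
      (Continuous.intervalIntegrable (by fun_prop) _ _)
      (Continuous.intervalIntegrable (by fun_prop) _ _) fun θ hθ => ?_
    have := cos_le_one_sub_mul_cos_sq (x := θ) (abs_le.2 hθ)
    refine exp_le_exp.2 ?_
    nlinarith
  have h2 : ∫ θ in (-π)..π, exp (-(2 / π ^ 2 * z) * θ ^ 2) ≤ √(π / (2 / π ^ 2 * z)) := by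
    rw [← integral_gaussian, intervalIntegral.integral_of_le (by linarith)]
    exact MeasureTheory.setIntegral_le_integral (integrable_exp_neg_mul_sq hb)
      (MeasureTheory.ae_of_all _ fun x => (exp_pos _).le)
  have h3 : √(π / (2 / π ^ 2 * z)) ≤ 1 / √z * (2 * π) := by
    rw [sqrt_le_left (by positivity), mul_pow, div_pow, sq_sqrt hz.le]
    have h4 : π / (2 / π ^ 2 * z) = π / 2 * π ^ 2 / z := by field_simp
    have h5 : 1 ^ 2 / z * (2 * π) ^ 2 = 4 * π ^ 2 / z := by ring
    rw [h4, h5]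
    have := pi_lt_four
    gcongr
    linarith
  rw [div_le_iff₀ (by positivity)]
  exact (h1.trans h2).trans h3

lemma valleePoussinGap.ge_of_exp {z : ℝ} (hz : 0 < z) (n N : ℕ) :
    ((N : ℝ) - n) - (N : ℝ) ^ 2 / √z ≤
      valleePoussinGap n N (fun θ => Real.exp (z * (Real.cos θ - 1))) := by
  refine le_trans ?_ (ge_of_nonneg (by fun_prop) fun θ => (Real.exp_pos _).le)
  have := mul_le_mul_of_nonneg_left (integral_exp_mul_cos_sub_one_le hz) (sq_nonneg (N : ℝ))
  simp only [Real.cos_zero, sub_self, mul_zero, Real.exp_zero, mul_one, mul_div_assoc]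
  rw [← mul_one_div ((N : ℝ) ^ 2)]
  linarith

lemma skellamWeight.hasSum_mul_cos_int (z θ : ℝ) :
    HasSum (fun p : ℕ × ℕ => skellamWeight z p * Real.cos ((((p.1 : ℤ) - p.2 : ℤ) : ℝ) * θ))
      (Real.exp (z * (Real.cos θ - 1))) := by
  push_cast
  exact hasSum_mul_cos z θ

/-- Every pair with difference at least N contributes its full weight times N - n, and no other pair
contributes negatively. -/
lemma valleePoussinGap.ge_of_exp_tilt {z s : ℝ} (hz : 0 < z) (hs : 0 ≤ s) {n N : ℕ} (hN : n ≤ N)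
    (hNs : (N : ℝ) ≤ z * Real.sinh s - √(2 * (z * Real.cosh s))) :
    ((N : ℝ) - n) * (Real.exp (-(z * legendreRate s) - s * √(2 * (z * Real.cosh s))) / 2) ≤
      valleePoussinGap n N (fun θ => Real.exp (z * (Real.cos θ - 1))) := by
  have hN0 : (0 : ℝ) ≤ (N : ℝ) - n := by simpa using hN
  have hsum : Summable fun p : ℕ × ℕ =>
      if (N : ℝ) ≤ (p.1 : ℝ) - p.2 then skellamWeight z p else 0 := by
    refine Summable.of_nonneg_of_le (fun p => ?_) (fun p => ?_) (skellamWeight.hasSum z).summable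
    all_goals have := skellamWeight.nonneg hz.le p
    all_goals split_ifs <;> simp [this]
  have h1 := skellamWeight.exp_le_of_hasSum_tail hz hs hNs hsum.hasSum
  have h2 := hasSum_of_cos n N (skellamWeight.hasSum z).summable (skellamWeight.nonneg hz.le)
    (skellamWeight.hasSum_mul_cos_int z)
  refine (mul_le_mul_of_nonneg_left h1 hN0).trans ?_
  refine hasSum_le (fun p => ?_) (hsum.hasSum.mul_left _) h2
  have hw := skellamWeight.nonneg hz.le p
  split_ifs with h
  · rw [map_cos_of_ge hN, mul_comm]
    have : (N : ℤ) ≤ (p.1 : ℤ) - p.2 := by exact_mod_cast h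
    omega
  · rw [mul_zero]
    exact mul_nonneg hw (map_cos_nonneg hN _)

/-! ### Upper bound for the degree. -/

/-- Truncating the Chebyshev series of `exp (z (t - 1))`: the error is a tail of a difference of
independent Poisson variables, bounded by Chernoff's inequality. -/
lemma exists_polynomial_approx_exp {z s ε : ℝ} (hz : 0 ≤ z) (hs : 0 ≤ s) (n : ℕ) (hε : 0 < ε) :
    ∃ P : Polynomial ℝ, P.natDegree ≤ n ∧ ∀ θ : ℝ,
      |P.eval (Real.cos θ) - Real.exp (z * (Real.cos θ - 1))| ≤
        2 * Real.exp (z * (Real.cosh s - 1) - s * (n + 1)) + ε := by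
  have hw := skellamWeight.nonneg hz
  have h1 := skellamWeight.hasSum z
  -- Infinitely many pairs share each difference; a finite set carrying mass above 1 - ε suffices
  -- and accounts for the extra ε.
  obtain ⟨F, hF⟩ : ∃ F : Finset (ℕ × ℕ), 1 - ε < ∑ p ∈ F, skellamWeight z p :=
    ((tendsto_order.1 h1).1 (1 - ε) (by linarith)).exists
  set F' := F.filter fun p => ((p.1 : ℤ) - p.2).natAbs ≤ n with hF'
  have htail : ∑ p ∈ F with ¬ ((p.1 : ℤ) - p.2).natAbs ≤ n, skellamWeight z p ≤
      2 * Real.exp (z * (Real.cosh s - 1) - s * (n + 1)) := by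
    -- The tilts s and -s together dominate both tails, whence the factor 2.
    have e1 := ((skellamWeight.hasSum_mul_exp z s).add
      (skellamWeight.hasSum_mul_exp z (-s))).mul_right (Real.exp (-(s * (n + 1))))
    rw [Real.cosh_neg, ← two_mul, mul_assoc, ← Real.exp_add, ← sub_eq_add_neg] at e1
    refine le_trans ?_ (sum_le_hasSum (F.filter fun p => ¬ ((p.1 : ℤ) - p.2).natAbs ≤ n)
      (fun p _ => ?_) e1)
    · refine Finset.sum_le_sum fun p hp => ?_
      have hp' := (Finset.mem_filter.1 hp).2
      have hk : (n : ℤ) + 1 ≤ (p.1 : ℤ) - p.2 ∨ (n : ℤ) + 1 ≤ -((p.1 : ℤ) - p.2) := by omega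
      have hp0 := hw p
      rw [← mul_add, mul_assoc]
      refine le_mul_of_one_le_right hp0 ?_
      rw [add_mul, ← Real.exp_add, ← Real.exp_add]
      rcases hk with hk | hk
      · have hk' : (n : ℝ) + 1 ≤ (p.1 : ℝ) - p.2 := by exact_mod_cast hk
        have : 1 ≤ Real.exp (s * ((p.1 : ℝ) - p.2) + -(s * (n + 1))) := by
          apply Real.one_le_exp
          nlinarith
        have := Real.exp_pos (-s * ((p.1 : ℝ) - p.2) + -(s * (n + 1)))
        linarith
      · have hk' : (n : ℝ) + 1 ≤ -((p.1 : ℝ) - p.2) := by exact_mod_cast hk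
        have : 1 ≤ Real.exp (-s * ((p.1 : ℝ) - p.2) + -(s * (n + 1))) := by
          apply Real.one_le_exp
          nlinarith
        have := Real.exp_pos (s * ((p.1 : ℝ) - p.2) + -(s * (n + 1)))
        linarith
    · have := hw p
      positivity
  have hsplit := Finset.sum_filter_add_sum_filter_not F
    (fun p : ℕ × ℕ => ((p.1 : ℤ) - p.2).natAbs ≤ n) (skellamWeight z)
  refine ⟨∑ p ∈ F', Polynomial.C (skellamWeight z p) *
    Polynomial.Chebyshev.T ℝ ((p.1 : ℤ) - p.2), ?_, fun θ => ?_⟩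
  · refine Polynomial.natDegree_sum_le_of_forall_le _ _ fun p hp => ?_
    refine (Polynomial.natDegree_C_mul_le _ _).trans ?_
    rw [Polynomial.Chebyshev.natDegree_T]
    exact (Finset.mem_filter.1 hp).2
  · have hc := skellamWeight.hasSum_mul_cos_int z θ
    have he : (∑ p ∈ F', Polynomial.C (skellamWeight z p) *
        Polynomial.Chebyshev.T ℝ ((p.1 : ℤ) - p.2)).eval (Real.cos θ) =
        ∑ p ∈ F', skellamWeight z p * Real.cos ((((p.1 : ℤ) - p.2 : ℤ) : ℝ) * θ) := by
      rw [Polynomial.eval_finsetSum]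
      refine Finset.sum_congr rfl fun p _ => ?_
      rw [Polynomial.eval_mul, Polynomial.eval_C, Polynomial.Chebyshev.T_real_cos]
    rw [he]
    -- The terms w(1 - cos) and w(1 + cos) are nonnegative, so their partial sums bound the error on
    -- either side by 1 - ∑ w over F'.
    have hlo := sum_le_hasSum F' (fun p _ => ?_) (h1.sub hc)
    have hhi := sum_le_hasSum F' (fun p _ => ?_) (h1.add hc)
    · rw [Finset.sum_sub_distrib] at hlo
      rw [Finset.sum_add_distrib] at hhi
      rw [abs_le]
      constructor <;> linarith
    · nlinarith [hw p, Real.neg_one_le_cos ((((p.1 : ℤ) - p.2 : ℤ) : ℝ) * θ)]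
    · nlinarith [hw p, Real.cos_le_one ((((p.1 : ℤ) - p.2 : ℤ) : ℝ) * θ)]

lemma exists_mem_approxDegreeSet {B δ η : ℝ} (hB : 0 < B) {n : ℕ} (hn : 0 < n)
    {P : Polynomial ℝ} (hP : P.natDegree ≤ n) (hη : η < δ)
    (h : ∀ θ : ℝ, |P.eval (Real.cos θ) - Real.exp (B / 2 * (Real.cos θ - 1))| ≤ η) :
    ∃ m ∈ approxDegreeSet B δ (fun x => Real.exp (-x)), m ≤ n := by
  set q : Polynomial ℝ := P.comp (1 - Polynomial.C (2 / B) * Polynomial.X) with hq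
  have hqn : q.natDegree ≤ n := by
    refine Polynomial.natDegree_comp_le.trans ?_
    have : (1 - Polynomial.C (2 / B) * Polynomial.X : Polynomial ℝ).natDegree ≤ 1 := by
      compute_degree
    nlinarith
  have hqe : ∀ x ∈ Set.Icc (0 : ℝ) B, |q.eval x - Real.exp (-x)| ≤ η := by
    intro x hx
    have hx1 : 2 / B * x ≤ 2 := by
      rw [div_mul_eq_mul_div, div_le_iff₀ hB]
      linarith [hx.2]
    have hx0 : 0 ≤ 2 / B * x := mul_nonneg (by positivity) hx.1
    have := h (Real.arccos (1 - 2 / B * x))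
    rw [Real.cos_arccos (by linarith) (by linarith)] at this
    rw [hq, Polynomial.eval_comp]
    have e : B / 2 * (1 - 2 / B * x - 1) = -x := by field_simp; ring
    rw [e] at this
    simpa using this
  rcases Nat.eq_zero_or_pos q.natDegree with h0 | h0
  -- Constants are not admissible: a linear term of slope (δ - η)/(2B) spends at most half of the
  -- slack on [0, B].
  · refine ⟨1, ⟨one_pos, q + Polynomial.C ((δ - η) / (2 * B)) * Polynomial.X, ?_,
      (η + δ) / 2, by linarith, fun x hx => ?_⟩, hn⟩
    · rw [Polynomial.natDegree_add_eq_right_of_natDegree_lt]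
      all_goals rw [Polynomial.natDegree_C_mul_X _ (div_pos (by linarith) (by linarith)).ne']
      omega
    · have h1 : 0 ≤ (δ - η) / (2 * B) * x :=
        mul_nonneg (div_nonneg (by linarith) (by linarith)) hx.1
      have h2 : (δ - η) / (2 * B) * x ≤ (δ - η) / 2 := by
        rw [div_mul_eq_mul_div, div_le_iff₀ (by linarith)]
        have := mul_le_mul_of_nonneg_left hx.2 (show 0 ≤ δ - η by linarith)
        linarith
      have h3 := abs_le.1 (hqe x hx)
      simp only [Polynomial.eval_add, Polynomial.eval_mul, Polynomial.eval_C, Polynomial.eval_X]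
      rw [abs_le]
      constructor <;> linarith
  · exact ⟨q.natDegree, ⟨h0, q, rfl, η, hη, hqe⟩, hqn⟩

/-- The Chernoff bound at the critical tilt, in terms of `D = (B / 2) sinh s`. -/
lemma exists_mem_approxDegreeSet_of_le {B δ s κ : ℝ} (hB : 0 < B) (hδ : 0 < δ) (hs : 0 < s)
    (hL : B / 2 * legendreRate s = Real.log δ⁻¹) (hκ0 : 0 ≤ κ)
    (hκ : Real.log 2 < κ * Real.log δ⁻¹)
    {n : ℕ} (hn : 0 < n) (hns : (1 + κ) * (B / 2 * Real.sinh s) ≤ n + 1) :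
    ∃ m ∈ approxDegreeSet B δ (fun x => Real.exp (-x)), m ≤ n := by
  set η := 2 * Real.exp (B / 2 * (Real.cosh s - 1) - s * (n + 1)) with hη
  have hηδ : η < δ := by
    -- Since sD ≥ zΦ(s) = L, the excess κD in the degree gains a factor e^{-κL} < 1/2, which pays
    -- for the two tails.
    have h1 : B / 2 * (Real.cosh s - 1) - s * (n + 1) ≤ -((1 + κ) * Real.log δ⁻¹) := by
      have h2 := mul_le_mul_of_nonneg_left hns hs.le
      have h3 := mul_le_mul_of_nonneg_left (legendreRate.le_mul_sinh s)
        (show 0 ≤ κ * (B / 2) by positivity)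
      rw [← hL]
      unfold legendreRate at *
      linarith
    calc η ≤ 2 * Real.exp (-((1 + κ) * Real.log δ⁻¹)) := by
          have := Real.exp_le_exp.2 h1
          linarith
      _ = Real.exp (Real.log 2 - (1 + κ) * Real.log δ⁻¹) := by
          rw [sub_eq_add_neg, Real.exp_add, Real.exp_log two_pos]
      _ < Real.exp (-Real.log δ⁻¹) := Real.exp_lt_exp.2 (by linarith)
      _ = δ := by rw [Real.log_inv, neg_neg, Real.exp_log hδ]
  obtain ⟨P, hP, hPe⟩ := exists_polynomial_approx_exp (z := B / 2) (by linarith) hs.le n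
    (half_pos (sub_pos.2 hηδ))
  exact exists_mem_approxDegreeSet hB hn hP (η := η + (δ - η) / 2) (by linarith) hPe

lemma expNegDegree_le {B δ s κ : ℝ} (hB : 0 < B) (hδ : 0 < δ) (hs : 0 < s)
    (hL : B / 2 * legendreRate s = Real.log δ⁻¹) (hκ0 : 0 ≤ κ)
    (hκ : Real.log 2 < κ * Real.log δ⁻¹) :
    expNegDegree B δ ≤ (1 + κ) * (B / 2 * Real.sinh s) + 1 := by
  have h0 : 0 < (1 + κ) * (B / 2 * Real.sinh s) := by
    have := Real.sinh_pos_iff.2 hs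
    positivity
  obtain ⟨m, hm, hmn⟩ := exists_mem_approxDegreeSet_of_le hB hδ hs hL hκ0 hκ
    (n := ⌈(1 + κ) * (B / 2 * Real.sinh s)⌉₊) (Nat.ceil_pos.2 h0)
    ((Nat.le_ceil _).trans (by linarith))
  have h1 : approxDegree B δ (fun x => Real.exp (-x)) ≤ ⌈(1 + κ) * (B / 2 * Real.sinh s)⌉₊ :=
    (Nat.sInf_le hm).trans hmn
  have h2 : expNegDegree B δ ≤ (⌈(1 + κ) * (B / 2 * Real.sinh s)⌉₊ : ℝ) := by
    unfold expNegDegree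
    exact_mod_cast h1
  exact h2.trans (Nat.ceil_lt_add_one h0.le).le

lemma exists_tilt {B δ : ℝ} (hB : 0 < B) (hδ : 0 < δ) (hδ1 : δ < 1) :
    ∃ s, 0 < s ∧ B / 2 * legendreRate s = Real.log δ⁻¹ := by
  have hL : 0 < Real.log δ⁻¹ := Real.log_pos (one_lt_inv₀ hδ |>.2 hδ1)
  obtain ⟨s, hs, h⟩ := legendreRate.exists_eq (u := Real.log δ⁻¹ / (B / 2)) (by positivity)
  exact ⟨s, hs, by rw [h]; field_simp⟩

lemma approxDegreeSet_nonempty {B δ : ℝ} (hB : 0 < B) (hδ : 0 < δ) (hδ1 : δ < 1) :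
    (approxDegreeSet B δ (fun x => Real.exp (-x))).Nonempty := by
  have hL : 0 < Real.log δ⁻¹ := Real.log_pos (one_lt_inv₀ hδ |>.2 hδ1)
  obtain ⟨s, hs, h⟩ := exists_tilt hB hδ hδ1
  obtain ⟨n, hn⟩ := exists_nat_ge ((1 + (Real.log δ⁻¹)⁻¹) * (B / 2 * Real.sinh s))
  obtain ⟨m, hm, -⟩ := exists_mem_approxDegreeSet_of_le hB hδ hs h
    (inv_nonneg.2 hL.le) (by
      rw [inv_mul_cancel₀ hL.ne']
      linarith [Real.log_two_lt_d9]) (Nat.succ_pos n) (by push_cast; linarith)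
  exact ⟨m, hm⟩

/-! ### Lower bounds for the degree. -/

/-- The lower bound by duality: the minimal degree controls the de la Vallée-Poussin gap. -/
lemma exists_degree_gap_le {B δ : ℝ} (hB : 0 < B) (hδ : 0 < δ) (hδ1 : δ < 1) :
    ∃ n : ℕ, 0 < n ∧ expNegDegree B δ = n ∧ ∀ N : ℕ, n ≤ N →
      valleePoussinGap n N (fun θ => Real.exp (B / 2 * (Real.cos θ - 1))) ≤ 2 * N * δ := by
  obtain ⟨h0, p, hp, η, hη, hpe⟩ := Nat.sInf_mem (approxDegreeSet_nonempty hB hδ hδ1)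
  refine ⟨_, h0, rfl, fun N hN => ?_⟩
  set P : Polynomial ℝ := p.comp (Polynomial.C (B / 2) * (1 - Polynomial.X)) with hPdef
  have hP : P.natDegree ≤ sInf (approxDegreeSet B δ fun x => Real.exp (-x)) := by
    refine Polynomial.natDegree_comp_le.trans ?_
    have : (Polynomial.C (B / 2) * (1 - Polynomial.X) : Polynomial ℝ).natDegree ≤ 1 := by
      compute_degree
    rw [hp]
    nlinarith
  refine (valleePoussinGap.le_of_approx hN hP (by fun_prop) (η := η) fun θ => ?_).trans ?_
  · have h1 := Real.cos_le_one θ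
    have h2 := Real.neg_one_le_cos θ
    have := hpe (B / 2 * (1 - Real.cos θ)) ⟨by nlinarith, by nlinarith⟩
    rw [hPdef, Polynomial.eval_comp]
    simp only [Polynomial.eval_mul, Polynomial.eval_C, Polynomial.eval_sub, Polynomial.eval_one,
      Polynomial.eval_X]
    rwa [show B / 2 * (Real.cos θ - 1) = -(B / 2 * (1 - Real.cos θ)) by ring]
  · exact mul_le_mul_of_nonneg_left hη.le (by positivity)

/-- For errors bounded away from `1 / 2` the degree is at least of order `√B`. -/
lemma exists_sqrt_le_expNegDegree {δ₀ : ℝ} (hδ₀ : δ₀ < 1 / 2) :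
    ∃ c : ℝ, 0 < c ∧ ∀ B δ : ℝ, 1 ≤ B → 0 < δ → δ ≤ δ₀ → c * √B ≤ expNegDegree B δ := by
  -- With N = Kn, K(1 - 2δ₀) ≥ 2 gives (K - 1) - 2Kδ₀ ≥ 1, so K²n/√z ≥ 1. This is where δ₀ < 1/2
  -- enters.
  obtain ⟨K, hK⟩ := exists_nat_ge (2 / (1 - 2 * δ₀))
  rw [div_le_iff₀ (by linarith)] at hK
  have hK0 : 0 < K := by
    rcases Nat.eq_zero_or_pos K with rfl | h
    · norm_num at hK
    · exact h
  have hK0' : (0 : ℝ) < K := by exact_mod_cast hK0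
  refine ⟨1 / (K ^ 2 * √2), by positivity, fun B δ hB hδ hδδ => ?_⟩
  obtain ⟨n, hn, hdn, hgap⟩ := exists_degree_gap_le (B := B) (by linarith) hδ (by linarith)
  have hn' : (0 : ℝ) < n := by exact_mod_cast hn
  have hz : 0 < √(B / 2) := Real.sqrt_pos.2 (by linarith)
  have h1 := (valleePoussinGap.ge_of_exp (z := B / 2) (by linarith) n (K * n)).trans
    (hgap (K * n) (Nat.le_mul_of_pos_left n hK0))
  push_cast at h1
  have h2 : 2 * (K * n) * δ ≤ 2 * (K * n) * δ₀ := mul_le_mul_of_nonneg_left hδδ (by positivity)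
  have h3 : (n : ℝ) * 1 ≤ n * (K ^ 2 * n / √(B / 2)) := by
    have e : ((K : ℝ) * n) ^ 2 / √(B / 2) = n * (K ^ 2 * n / √(B / 2)) := by ring
    rw [e] at h1
    have := mul_le_mul_of_nonneg_left hK hn'.le
    linarith
  have h4 := le_of_mul_le_mul_left h3 hn'
  rw [one_le_div hz, Real.sqrt_div' _ zero_le_two, div_le_iff₀ (by positivity)] at h4
  rw [hdn, div_mul_eq_mul_div, one_mul, div_le_iff₀ (by positivity)]
  linarith

lemma legendreRate.sq_mul_cosh_le {s : ℝ} (hs : 0 ≤ s) :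
    s ^ 2 * Real.cosh s ≤ 2 * (1 + s) * legendreRate s := by
  have h1 := mul_le_mul_of_nonneg_left (mul_cosh_le hs) hs
  have h2 := mul_le_mul_of_nonneg_left (half_mul_sinh_le hs) (show 0 ≤ 1 + s by linarith)
  linarith

lemma legendreRate.mul_cosh_le_mul_sinh_sq {s : ℝ} (hs : 0 ≤ s) :
    legendreRate s * Real.cosh s ≤ (1 + s) * Real.sinh s ^ 2 := by
  have h0 := Real.sinh_nonneg_iff.2 hs
  have h1 := mul_le_mul_of_nonneg_left (mul_cosh_le hs) h0
  have h2 := mul_le_mul_of_nonneg_right (le_mul_sinh s) (Real.cosh_pos s).le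
  linarith

/-- At the critical tilt the standard deviation is small compared with `z sinh s` and, times the
tilt, with `L`. -/
lemma legendreRate.sqrt_mul_cosh_le {z s L ε : ℝ} (hz2 : 1 / 2 ≤ z) (hs : 0 < s) (hLpos : 0 < L)
    (hL : z * legendreRate s = L) (hε : 0 < ε) (hε1 : ε ≤ 1) (hLε : 48 / ε ^ 2 ≤ √L) :
    √(2 * (z * Real.cosh s)) ≤ ε / 2 * (z * Real.sinh s) ∧
      s * √(2 * (z * Real.cosh s)) ≤ ε / 2 * L ∧
      1 ≤ ε / 2 * (z * Real.sinh s) ∧ 48 ≤ ε ^ 2 * L := by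
  have hz0 : 0 < z := by linarith
  have hsinh : 0 < Real.sinh s := Real.sinh_pos_iff.2 hs
  set D := z * Real.sinh s with hD
  have hD0 : 0 < D := mul_pos hz0 hsinh
  set r := √L with hr
  have hr2 : r ^ 2 = L := Real.sq_sqrt hLpos.le
  have hr0 : 0 < r := Real.sqrt_pos.2 hLpos
  have hrε : 48 ≤ ε ^ 2 * r := by
    rw [div_le_iff₀ (by positivity)] at hLε
    linarith
  have hr48 : 48 ≤ r := by
    have : ε ^ 2 * r ≤ 1 * r := mul_le_mul_of_nonneg_right (pow_le_one₀ hε.le hε1) hr0.le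
    linarith
  have hΦ := legendreRate.pos hs
  have hsr : s ≤ 2 * r := by
    have h1 := legendreRate.half_sq_le hs.le
    have : s ^ 2 ≤ (2 * r) ^ 2 := by nlinarith
    exact (pow_le_pow_iff_left₀ hs.le (by positivity) two_ne_zero).1 this
  -- From ε²√L ≥ 48 one gets (ε/2)²L ≥ 12√L, while s ≤ 2√L bounds the left side by 4 + 8√L.
  have hmain : 4 * (1 + s) ≤ (ε / 2) ^ 2 * L := by
    have : (ε / 2) ^ 2 * L ≥ 12 * r := by rw [← hr2]; nlinarith
    linarith
  have hε2L : 48 ≤ ε ^ 2 * L := by rw [← hr2]; nlinarith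
  have hcosh := Real.cosh_pos s
  have hA : √(2 * (z * Real.cosh s)) ≤ ε / 2 * D := by
    rw [Real.sqrt_le_left (by positivity)]
    have h1 := legendreRate.mul_cosh_le_mul_sinh_sq hs.le
    have h2 : 4 * (1 + s) * Real.cosh s * z ≤ (ε / 2) ^ 2 * z * ((1 + s) * Real.sinh s ^ 2) * z := by
      calc 4 * (1 + s) * Real.cosh s * z ≤ (ε / 2) ^ 2 * L * Real.cosh s * z := by gcongr
        _ = (ε / 2) ^ 2 * z * (legendreRate s * Real.cosh s) * z := by rw [← hL]; ring
        _ ≤ _ := by gcongr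
    have h3 : (1 + s) * (4 * Real.cosh s * z) ≤ (1 + s) * ((ε / 2 * D) ^ 2) := by
      rw [hD]; linarith
    have h4 := le_of_mul_le_mul_left h3 (by linarith)
    have : 0 < z * Real.cosh s := by positivity
    linarith
  have hC : s * √(2 * (z * Real.cosh s)) ≤ ε / 2 * L := by
    have h1 := legendreRate.sq_mul_cosh_le hs.le
    have h2 : s * √(2 * (z * Real.cosh s)) = √(s ^ 2 * (2 * (z * Real.cosh s))) := by
      rw [Real.sqrt_mul (sq_nonneg s), Real.sqrt_sq hs.le]
    rw [h2, Real.sqrt_le_left (by positivity)]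
    calc s ^ 2 * (2 * (z * Real.cosh s)) = 2 * z * (s ^ 2 * Real.cosh s) := by ring
      _ ≤ 2 * z * (2 * (1 + s) * legendreRate s) := by gcongr
      _ = 4 * (1 + s) * L := by rw [← hL]; ring
      _ ≤ (ε / 2) ^ 2 * L * L := by gcongr
      _ = _ := by ring
  have hD1 : 1 ≤ ε / 2 * D := by
    have h1 := legendreRate.le_sinh_sq hs.le
    have h2 : L / 2 ≤ D ^ 2 := by
      rw [hD, ← hL]
      calc z * legendreRate s / 2 = z * (1 / 2) * legendreRate s := by ring
        _ ≤ z * z * Real.sinh s ^ 2 := by gcongr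
        _ = _ := by ring
    have h3 : 1 ^ 2 ≤ (ε / 2 * D) ^ 2 := by nlinarith [sq_nonneg ε]
    exact (pow_le_pow_iff_left₀ zero_le_one (by positivity) two_ne_zero).1 h3
  exact ⟨hA, hC, hD1, hε2L⟩

/-- Cramér's lower bound at a tilt slightly below the critical one. -/
lemma le_expNegDegree {B δ s ε : ℝ} (hB : 1 ≤ B) (hδ : 0 < δ) (hδ1 : δ < 1) (hs : 0 < s)
    (hL : B / 2 * legendreRate s = Real.log δ⁻¹) (hε : 0 < ε) (hε1 : ε ≤ 1)
    (hLε : 48 / ε ^ 2 ≤ √(Real.log δ⁻¹)) :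
    (1 - 3 * ε) * (B / 2 * Real.sinh s) ≤ expNegDegree B δ := by
  have hLpos : 0 < Real.log δ⁻¹ := Real.log_pos (one_lt_inv₀ hδ |>.2 hδ1)
  have hδL : δ = Real.exp (-Real.log δ⁻¹) := by rw [Real.log_inv, neg_neg, Real.exp_log hδ]
  have hz2 : 1 / 2 ≤ B / 2 := by linarith
  have hz0 : 0 < B / 2 := by linarith
  obtain ⟨hA, hC, hD1, hε2L⟩ := legendreRate.sqrt_mul_cosh_le hz2 hs hLpos hL hε hε1 hLε
  have hsinh : 0 < Real.sinh s := Real.sinh_pos_iff.2 hs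
  have hD0 : 0 < B / 2 * Real.sinh s := mul_pos hz0 hsinh
  obtain ⟨n, hn, hdn, hgap⟩ := exists_degree_gap_le (B := B) (by linarith) hδ hδ1
  generalize Real.log δ⁻¹ = L at *
  generalize B / 2 = z at *
  generalize hD : z * Real.sinh s = D at *
  rw [hdn]
  -- Three levels are used: n < (1 - 3ε)D, N near (1 - 2ε)D, and tilted mean (1 - ε)D. The first
  -- spacing gives N - n ≥ εD; the second absorbs the deviation and the rounding of N, at most εD/2
  -- each.
  by_contra! hlt
  have hn0 : (0 : ℝ) < n := by exact_mod_cast hn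
  have hε3 : ε < 1 / 3 := by
    by_contra! h
    have : (1 - 3 * ε) * D ≤ 0 := mul_nonpos_of_nonpos_of_nonneg (by linarith) hD0.le
    linarith
  set t := Real.arsinh ((1 - ε) * Real.sinh s) with ht
  have hsinht : Real.sinh t = (1 - ε) * Real.sinh s := Real.sinh_arsinh _
  have ht0 : 0 ≤ t := Real.arsinh_nonneg_iff.2 (mul_nonneg (by linarith) hsinh.le)
  have hts : t ≤ s := by
    rw [← Real.sinh_le_sinh, hsinht]
    nlinarith
  have hcosht : Real.cosh t ≤ Real.cosh s := by
    rw [Real.cosh_le_cosh, abs_of_nonneg ht0, abs_of_pos hs]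
    exact hts
  have hsqrt : √(2 * (z * Real.cosh t)) ≤ √(2 * (z * Real.cosh s)) := by
    apply Real.sqrt_le_sqrt
    gcongr
  -- By convexity the smaller tilt saves εL in the exponent; the deviation term spends at most half
  -- of it.
  have hrate := legendreRate.le_of_sinh_eq (s := s) (show 0 ≤ 1 - ε by linarith) (by linarith)
    hsinht
  set N := ⌈(1 - 2 * ε) * D⌉₊ with hN
  have hN1 : (1 - 2 * ε) * D ≤ N := Nat.le_ceil _
  have hN2 : (N : ℝ) < (1 - 2 * ε) * D + 1 :=
    Nat.ceil_lt_add_one (mul_nonneg (by linarith) hD0.le)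
  have hnN : n ≤ N := by
    have : (n : ℝ) ≤ N := by nlinarith
    exact_mod_cast this
  have h1 := (valleePoussinGap.ge_of_exp_tilt hz0 ht0 hnN (by
    rw [hsinht]
    have : z * ((1 - ε) * Real.sinh s) = (1 - ε) * D := by rw [← hD]; ring
    linarith)).trans (hgap N hnN)
  have h2 : Real.exp (-L + ε / 2 * L) ≤
      Real.exp (-(z * legendreRate t) - t * √(2 * (z * Real.cosh t))) := by
    refine Real.exp_le_exp.2 ?_
    have h3 : t * √(2 * (z * Real.cosh t)) ≤ s * √(2 * (z * Real.cosh s)) :=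
      mul_le_mul hts hsqrt (Real.sqrt_nonneg _) hs.le
    have h4 := mul_le_mul_of_nonneg_left hrate hz0.le
    have h5 : z * ((1 - ε) * legendreRate s) = (1 - ε) * L := by rw [← hL]; ring
    linarith
  have h3 : ε * D * (Real.exp (-L + ε / 2 * L) / 2) ≤ 2 * D * δ := by
    calc ε * D * (Real.exp (-L + ε / 2 * L) / 2) ≤ ((N : ℝ) - n) *
          (Real.exp (-(z * legendreRate t) - t * √(2 * (z * Real.cosh t))) / 2) := by
          refine mul_le_mul (by linarith) (by linarith) (by positivity) ?_
          exact sub_nonneg.2 (by exact_mod_cast hnN)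
      _ ≤ 2 * N * δ := h1
      _ ≤ 2 * D * δ := mul_le_mul_of_nonneg_right (by linarith) hδ.le
  rw [Real.exp_add, ← hδL] at h3
  -- Cancelling Dδ leaves ε e^{εL/2} ≤ 4, which contradicts ε²L ≥ 48.
  have h4 : ε * (ε / 2 * L + 1) ≤ 4 := by
    have h5 : (D * δ) * (ε * Real.exp (ε / 2 * L)) ≤ (D * δ) * 4 := by linarith
    have h6 := le_of_mul_le_mul_left h5 (by positivity)
    have h7 := mul_le_mul_of_nonneg_left (Real.add_one_le_exp (ε / 2 * L)) hε.le
    linarith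
  nlinarith

/-! ### Order of magnitude. -/

lemma log_two_lt_log_inv {δ : ℝ} (hδ : 0 < δ) (h : δ < 1 / 2) : Real.log 2 < Real.log δ⁻¹ := by
  refine Real.log_lt_log two_pos ?_
  rw [lt_inv_comm₀ two_pos hδ]
  linarith

/-- The order of magnitude `max {√(B L), L / log max {2, L / B}}` of the degree, `L = log δ⁻¹`. -/
noncomputable def degreeOrder (B L : ℝ) : ℝ :=
  max (√(B * L)) (L / Real.log (max 2 (B⁻¹ * L)))

namespace degreeOrder

lemma eq_mul_max {B L s : ℝ} (hB : 0 < B) (hL : B / 2 * legendreRate s = L) :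
    degreeOrder B L = B / 2 * max (√(2 * legendreRate s))
      (legendreRate s / Real.log (max 2 (legendreRate s / 2))) := by
  have h1 : B⁻¹ * L = legendreRate s / 2 := by rw [← hL]; field_simp
  have h2 : √(B * L) = B / 2 * √(2 * legendreRate s) := by
    rw [← hL, show B * (B / 2 * legendreRate s) = (B / 2) ^ 2 * (2 * legendreRate s) by ring,
      Real.sqrt_mul (by positivity), Real.sqrt_sq (by positivity)]
  rw [degreeOrder, h1, h2, mul_max_of_nonneg _ _ (by positivity), ← hL, mul_div_assoc]

lemma le_mul_sinh {B L s : ℝ} (hB : 0 < B) (hs : 0 < s) (hL : B / 2 * legendreRate s = L) :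
    degreeOrder B L ≤ 8 * (B / 2 * Real.sinh s) := by
  have := mul_le_mul_of_nonneg_left (legendreRate.max_le_sinh hs) (show 0 ≤ B / 2 by positivity)
  rw [eq_mul_max hB hL]
  linarith

lemma mul_sinh_le {B L s : ℝ} (hB : 0 < B) (hs : 0 < s) (hL : B / 2 * legendreRate s = L) :
    B / 2 * Real.sinh s ≤ 4 * degreeOrder B L := by
  have := mul_le_mul_of_nonneg_left (legendreRate.sinh_le_max hs) (show 0 ≤ B / 2 by positivity)
  rw [eq_mul_max hB hL]
  linarith

lemma div_log_le {L : ℝ} (hL : 0 ≤ L) (v : ℝ) : L / Real.log (max 2 v) ≤ 2 * L := by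
  have h1 : Real.log 2 ≤ Real.log (max 2 v) := Real.log_le_log two_pos (le_max_left _ _)
  have h2 := Real.log_two_gt_d9
  rw [div_le_iff₀ (by linarith)]
  nlinarith

lemma le_two_mul_sqrt {B L : ℝ} (hL : 0 ≤ L) (hLB : L ≤ B) :
    degreeOrder B L ≤ 2 * √(B * L) := by
  refine max_le (by linarith [Real.sqrt_nonneg (B * L)]) ((div_log_le hL _).trans ?_)
  have : L ≤ √(B * L) := Real.le_sqrt_of_sq_le (by nlinarith)
  linarith

/-- For bounded L the order is at most a constant times √B, where the spike argument already
suffices. -/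
lemma le_mul_sqrt {B L R : ℝ} (hB : 1 ≤ B) (hL : 0 ≤ L) (hR : 1 ≤ R) (hLR : √L ≤ R) :
    degreeOrder B L ≤ 2 * R ^ 2 * √B := by
  have hB1 : 1 ≤ √B := Real.one_le_sqrt.2 hB
  have hLR2 : L ≤ R ^ 2 := (Real.sqrt_le_left (by linarith)).1 hLR
  refine max_le ?_ ((div_log_le hL _).trans ?_)
  · rw [Real.sqrt_mul (by linarith)]
    have h1 := mul_le_mul_of_nonneg_left hLR (Real.sqrt_nonneg B)
    have h2 : √B * R ≤ √B * (2 * R ^ 2) :=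
      mul_le_mul_of_nonneg_left (by nlinarith) (Real.sqrt_nonneg B)
    linarith
  · nlinarith

end degreeOrder

lemma expNegDegree_le_degreeOrder {B δ : ℝ} (hB : 1 ≤ B) (hδ : 0 < δ) (hδ2 : δ < 1 / 2) :
    expNegDegree B δ ≤ 20 * degreeOrder B (Real.log δ⁻¹) := by
  have hB0 : 0 < B := by linarith
  have h2 := Real.log_two_gt_d9
  have hL := log_two_lt_log_inv hδ hδ2
  obtain ⟨s, hs, hsL⟩ := exists_tilt hB0 hδ (by linarith)
  -- With κ = 2 the degree is at most 3D + 1 ≤ 5D, as D ≥ 1/2 below; and D is at most 4 times the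
  -- order.
  have h1 := expNegDegree_le hB0 hδ hs hsL zero_le_two (by linarith)
  have h3 := degreeOrder.mul_sinh_le hB0 hs hsL
  have hsinh : 0 < Real.sinh s := Real.sinh_pos_iff.2 hs
  have h4 : 1 / 2 ≤ B / 2 * Real.sinh s := by
    have h5 : (1 / 2 : ℝ) ^ 2 ≤ (B / 2 * Real.sinh s) ^ 2 := by
      calc (1 / 2 : ℝ) ^ 2 ≤ 1 / 2 * Real.log δ⁻¹ := by linarith
        _ = 1 / 2 * (B / 2) * legendreRate s := by rw [← hsL]; ring
        _ ≤ B / 2 * (B / 2) * Real.sinh s ^ 2 := by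
          have := legendreRate.le_sinh_sq hs.le
          have := legendreRate.pos hs
          gcongr
        _ = _ := by ring
    exact (pow_le_pow_iff_left₀ (by norm_num) (by positivity) two_ne_zero).1 h5
  linarith

lemma exists_degreeOrder_le {δ₀ : ℝ} (hδ₀ : δ₀ < 1 / 2) :
    ∃ c : ℝ, 0 < c ∧ ∀ B δ : ℝ, 1 ≤ B → 0 < δ → δ ≤ δ₀ →
      c * degreeOrder B (Real.log δ⁻¹) ≤ expNegDegree B δ := by
  obtain ⟨c, hc, h⟩ := exists_sqrt_le_expNegDegree hδ₀
  refine ⟨min (1 / 16) (c / (2 * 1728 ^ 2)), by positivity, fun B δ hB hδ hδδ => ?_⟩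
  have hB0 : 0 < B := by linarith
  have hL := log_two_lt_log_inv hδ (hδδ.trans_lt hδ₀)
  have hL0 : 0 < Real.log δ⁻¹ := (Real.log_pos one_lt_two).trans hL
  have hM : 0 ≤ degreeOrder B (Real.log δ⁻¹) := le_max_of_le_left (Real.sqrt_nonneg _)
  -- The threshold is 48/ε² at ε = 1/6, for which Cramér's bound keeps D/2, and D is at least an
  -- eighth of the order.
  rcases le_total 1728 (√(Real.log δ⁻¹)) with h1 | h1
  · obtain ⟨s, hs, hsL⟩ := exists_tilt hB0 hδ (by linarith)
    have h2 := le_expNegDegree (ε := 1 / 6) hB hδ (by linarith) hs hsL (by norm_num) (by norm_num)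
      ((show (48 : ℝ) / (1 / 6) ^ 2 = 1728 by norm_num).trans_le h1)
    have h3 := degreeOrder.le_mul_sinh hB0 hs hsL
    have h4 := mul_le_mul_of_nonneg_right (min_le_left (1 / 16) (c / (2 * 1728 ^ 2))) hM
    linarith
  · have h2 := degreeOrder.le_mul_sqrt hB hL0.le (by norm_num) h1
    have h3 := mul_le_mul_of_nonneg_right (min_le_right (1 / 16) (c / (2 * 1728 ^ 2))) hM
    have h4 := mul_le_mul_of_nonneg_left h2 (show 0 ≤ c / (2 * 1728 ^ 2) by positivity)
    have h5 : c / (2 * 1728 ^ 2) * (2 * 1728 ^ 2 * √B) = c * √B := by field_simp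
    linarith [h B δ hB hδ hδδ]

/-- Without the truncation at `2` the order of magnitude changes by a bounded factor only. -/
lemma degreeOrder_untruncated {B L ρ : ℝ} (hB : 0 < B) (hL : 0 < L) (hρ : 1 < ρ)
    (h : B⁻¹ * L < 1 ∨ ρ ≤ B⁻¹ * L) :
    degreeOrder B L ≤ 2 * max (√(B * L)) (L / Real.log (B⁻¹ * L)) ∧
      max (√(B * L)) (L / Real.log (B⁻¹ * L)) ≤
        max 1 (Real.log 2 / Real.log ρ) * degreeOrder B L := by
  set K := max 1 (Real.log 2 / Real.log ρ) with hK
  have hK1 : 1 ≤ K := le_max_left _ _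
  have hv : 0 < B⁻¹ * L := by positivity
  have hsq := Real.sqrt_nonneg (B * L)
  have hM : √(B * L) ≤ degreeOrder B L := le_max_left _ _
  have hM2 : L / Real.log (max 2 (B⁻¹ * L)) ≤ degreeOrder B L := le_max_right _ _
  have hM0 := hsq.trans hM
  have hKM : degreeOrder B L ≤ K * degreeOrder B L := le_mul_of_one_le_left hM0 hK1
  rcases h with h | h
  -- Below 1 the logarithm is negative, so the untruncated maximum is its square-root entry.
  · have hneg : L / Real.log (B⁻¹ * L) ≤ 0 :=
      div_nonpos_of_nonneg_of_nonpos hL.le (Real.log_nonpos hv.le h.le)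
    have hLB : L ≤ B := by
      rw [inv_mul_lt_iff₀ hB] at h
      linarith
    rw [max_eq_left (hneg.trans hsq)]
    exact ⟨degreeOrder.le_two_mul_sqrt hL.le hLB, hM.trans hKM⟩
  · have hlog : 0 < Real.log (B⁻¹ * L) := Real.log_pos (by linarith)
    have hlogρ : 0 < Real.log ρ := Real.log_pos hρ
    have hlogm := legendreRate.log_max_pos (B⁻¹ * L)
    have hle : Real.log (B⁻¹ * L) ≤ Real.log (max 2 (B⁻¹ * L)) :=
      Real.log_le_log hv (le_max_right _ _)
    constructor
    · have h1 : degreeOrder B L ≤ max (√(B * L)) (L / Real.log (B⁻¹ * L)) :=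
        max_le_max_left _ (div_le_div_of_nonneg_left hL.le hlog hle)
      linarith
    · refine max_le (hM.trans hKM) ?_
      refine le_trans ?_ (mul_le_mul_of_nonneg_left hM2 (by linarith))
      rw [← mul_div_assoc, div_le_div_iff₀ hlog hlogm]
      have h1 : Real.log (max 2 (B⁻¹ * L)) ≤ K * Real.log (B⁻¹ * L) := by
        rcases le_total 2 (B⁻¹ * L) with h2 | h2
        · rw [max_eq_right h2]
          exact le_mul_of_one_le_left hlog.le hK1
        · rw [max_eq_left h2]
          have h3 : Real.log 2 ≤ K * Real.log ρ := (div_le_iff₀ hlogρ).1 (le_max_right _ _)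
          have h4 : Real.log ρ ≤ Real.log (B⁻¹ * L) := Real.log_le_log (by linarith) h
          exact h3.trans (mul_le_mul_of_nonneg_left h4 (by linarith))
      nlinarith

/-- If L > B ≥ e^{aL}, then e^{aL} ≥ (aL)²/2 gives L ≤ 2/a², which bounds both B and 1/δ. -/
lemma log_inv_le_of_rpow_le {B δ a : ℝ} (hδ : 0 < δ) (hδ1 : δ < 1) (ha : 0 < a)
    (hK : 2 / a ^ 2 + Real.exp (2 / a ^ 2) ≤ B + δ⁻¹) (h : δ ^ (-a) ≤ B) :
    Real.log δ⁻¹ ≤ B := by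
  have hL : 0 < Real.log δ⁻¹ := Real.log_pos (one_lt_inv₀ hδ |>.2 hδ1)
  have hexp : Real.exp (Real.log δ⁻¹) = δ⁻¹ := Real.exp_log (inv_pos.2 hδ)
  by_contra! hlt
  rw [Real.rpow_def_of_pos hδ] at h
  have h1 : Real.log δ * -a = a * Real.log δ⁻¹ := by rw [Real.log_inv]; ring
  rw [h1] at h
  have h2 := Real.quadratic_le_exp_of_nonneg (mul_pos ha hL).le
  have h3 : Real.log δ⁻¹ * (a ^ 2 * Real.log δ⁻¹) ≤ Real.log δ⁻¹ * 2 := by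
    have := mul_pos ha hL
    nlinarith
  have h4 : Real.log δ⁻¹ ≤ 2 / a ^ 2 := by
    rw [le_div_iff₀ (by positivity)]
    have := le_of_mul_le_mul_left h3 hL
    linarith
  have h5 := Real.exp_le_exp.2 h4
  linarith

/-! ### Leading constants. -/

/-- Whenever `log δ⁻¹ → ∞`, the degree is asymptotic to `(B / 2) sinh s`, where `s` solves
`(B / 2) (1 - cosh s + s sinh s) = log δ⁻¹`. -/
lemma tendsto_expNegDegree_div {ι : Type u} {l : Filter ι} {B δ s : ι → ℝ}
    (hB : ∀ i, 1 ≤ B i) (hδ : ∀ i, 0 < δ i) (hδ1 : ∀ i, δ i < 1) (hs : ∀ i, 0 < s i)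
    (hL : ∀ i, B i / 2 * legendreRate (s i) = Real.log (δ i)⁻¹)
    (htop : Tendsto (fun i => Real.log (δ i)⁻¹) l atTop) :
    Tendsto (fun i => expNegDegree (B i) (δ i) / (B i / 2 * Real.sinh (s i))) l (𝓝 1) := by
  have key : ∀ ε : ℝ, 0 < ε → ε ≤ 1 → ∀ᶠ i in l,
      (1 - 3 * ε) ≤ expNegDegree (B i) (δ i) / (B i / 2 * Real.sinh (s i)) ∧
      expNegDegree (B i) (δ i) / (B i / 2 * Real.sinh (s i)) ≤ 1 + 3 * ε := by
    intro ε hε hε1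
    filter_upwards [(Real.tendsto_sqrt_atTop.comp htop).eventually_ge_atTop (48 / ε ^ 2),
      htop.eventually_gt_atTop (Real.log 2 / ε)] with i h1 h2
    have hB0 : 0 < B i := by linarith [hB i]
    have hL0 : 0 < Real.log (δ i)⁻¹ := Real.log_pos (one_lt_inv₀ (hδ i) |>.2 (hδ1 i))
    have hsinh : 0 < Real.sinh (s i) := Real.sinh_pos_iff.2 (hs i)
    have hlo := le_expNegDegree (hB i) (hδ i) (hδ1 i) (hs i) (hL i) hε hε1 h1
    rw [div_lt_iff₀ hε, mul_comm] at h2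
    have hhi := expNegDegree_le hB0 (hδ i) (hs i) (hL i) hε.le h2
    have h3 := (legendreRate.sqrt_mul_cosh_le (by linarith [hB i]) (hs i) hL0 (hL i) hε hε1
      h1).2.2.1
    rw [le_div_iff₀ (by positivity), div_le_iff₀ (by positivity)]
    constructor
    · exact hlo
    · have : 0 < B i / 2 * Real.sinh (s i) := by positivity
      nlinarith
  rw [Metric.tendsto_nhds]
  intro e he
  filter_upwards [key (min 1 (e / 6)) (by positivity) (min_le_left _ _)] with i hi
  have := min_le_right 1 (e / 6)
  rw [Real.dist_eq, abs_lt]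
  constructor <;> linarith [hi.1, hi.2]

namespace IsParamFamily

variable {ι : Type u} {l : Filter ι} {B δ : ι → ℝ}

lemma log_inv_pos (h : IsParamFamily l B δ) (i : ι) : 0 < Real.log (δ i)⁻¹ :=
  Real.log_pos (one_lt_inv₀ (h.pos i) |>.2 (h.lt_one i))

lemma exists_tilt (h : IsParamFamily l B δ) : ∃ s : ι → ℝ, ∀ i, 0 < s i ∧
    B i / 2 * legendreRate (s i) = Real.log (δ i)⁻¹ := by
  choose s hs using fun i => _root_.exists_tilt (B := B i) (by linarith [h.one_le i])
    (h.pos i) (h.lt_one i)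
  exact ⟨s, hs⟩

/-- If L stayed bounded, so would both B and 1/δ = e^L. It is applied with F the identity, a linear
map and the exponential. -/
lemma tendsto_log_of_le (h : IsParamFamily l B δ) (F : ℝ → ℝ) (hF : Monotone F)
    (hB : ∀ᶠ i in l, B i ≤ F (Real.log (δ i)⁻¹)) :
    Tendsto (fun i => Real.log (δ i)⁻¹) l atTop := by
  refine tendsto_atTop.2 fun R => ?_
  filter_upwards [hB, h.tendsto.eventually_gt_atTop (F R + Real.exp R)] with i h1 h2
  by_contra! h3
  have h4 := hF h3.le
  have h5 := Real.exp_le_exp.2 h3.le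
  rw [Real.exp_log (inv_pos.2 (h.pos i))] at h5
  linarith

lemma legendreRate_tilt_eq (h : IsParamFamily l B δ) {s : ι → ℝ}
    (hs : ∀ i, B i / 2 * legendreRate (s i) = Real.log (δ i)⁻¹) (i : ι) :
    legendreRate (s i) / 2 = (B i)⁻¹ * Real.log (δ i)⁻¹ := by
  have := h.one_le i
  rw [← hs i]
  field_simp

/-- Here the tilt tends to infinity, so sinh s is asymptotic to Φ(s)/log(Φ(s)/2). -/
theorem isEquivalent_of_isLittleO_log (h : IsParamFamily l B δ)
    (ho : B =o[l] (fun i => Real.log (δ i)⁻¹)) :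
    (fun i => expNegDegree (B i) (δ i)) ~[l]
      (fun i => Real.log (δ i)⁻¹ / Real.log ((B i)⁻¹ * Real.log (δ i)⁻¹)) := by
  obtain ⟨s, hs⟩ := h.exists_tilt
  have hb : ∀ k : ℝ, 0 < k → ∀ᶠ i in l, k * B i ≤ Real.log (δ i)⁻¹ := fun k hk => by
    filter_upwards [isLittleO_iff.1 ho (inv_pos.2 hk)] with i hi
    rw [Real.norm_of_nonneg (by linarith [h.one_le i]), Real.norm_of_nonneg (h.log_inv_pos i).le,
      le_inv_mul_iff₀ hk] at hi
    exact hi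
  have htop : Tendsto (fun i => Real.log (δ i)⁻¹) l atTop :=
    h.tendsto_log_of_le id monotone_id (by simpa using hb 1 one_pos)
  have hsTop : Tendsto s l atTop := by
    refine tendsto_atTop.2 fun R => ?_
    have hR : 0 < max R 1 := by positivity
    filter_upwards [hb (legendreRate (max R 1)) (legendreRate.pos hR)] with i hi
    refine (le_max_left R 1).trans (not_lt.1 fun hlt => ?_)
    have h1 := legendreRate.strictMonoOn (hs i).1.le hR.le hlt
    have h2 := (hs i).2
    have h3 := h.one_le i
    have h4 := legendreRate.pos (hs i).1
    nlinarith
  have h1 := tendsto_expNegDegree_div h.one_le h.pos h.lt_one (fun i => (hs i).1)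
    (fun i => (hs i).2) htop
  have h2 := h1.mul (legendreRate.tendsto_sinh_mul_log_div.comp hsTop)
  rw [one_mul] at h2
  refine isEquivalent_of_tendsto_one (h2.congr fun i => ?_)
  have h3 := h.one_le i
  have h4 := legendreRate.pos (hs i).1
  have h5 := Real.sinh_pos_iff.2 (hs i).1
  simp only [Function.comp_apply, Pi.div_apply]
  rw [← h.legendreRate_tilt_eq (fun i => (hs i).2) i, ← (hs i).2, div_div_eq_mul_div]
  field_simp

/-- Here the tilt tends to 0, where sinh s is asymptotic to √(2Φ(s)). The bound B ≤ δ^{-o(1)} serves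
only to force L → ∞, through B ≤ e^L eventually. -/
theorem isEquivalent_of_log_isLittleO (h : IsParamFamily l B δ)
    (ho : (fun i => Real.log (δ i)⁻¹) =o[l] B)
    (hε : ∃ ε : ι → ℝ, Tendsto ε l (𝓝 0) ∧ ∀ᶠ i in l, B i ≤ (δ i) ^ (-(ε i))) :
    (fun i => expNegDegree (B i) (δ i)) ~[l]
      (fun i => √(B i * Real.log (δ i)⁻¹)) := by
  obtain ⟨s, hs⟩ := h.exists_tilt
  have htop : Tendsto (fun i => Real.log (δ i)⁻¹) l atTop := by
    obtain ⟨ε, hε0, hεB⟩ := hε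
    refine h.tendsto_log_of_le Real.exp Real.exp_monotone ?_
    filter_upwards [hεB, hε0.eventually_le_const one_pos] with i h1 h2
    refine h1.trans ?_
    rw [Real.rpow_def_of_pos (h.pos i), Real.exp_le_exp]
    have := h.log_inv_pos i
    rw [Real.log_inv] at this ⊢
    nlinarith
  have hs0 : Tendsto s l (𝓝[>] 0) := by
    refine tendsto_nhdsWithin_iff.2 ⟨?_, Eventually.of_forall fun i => (hs i).1⟩
    rw [Metric.tendsto_nhds]
    intro e he
    filter_upwards [isLittleO_iff.1 ho (show 0 < e ^ 2 / 8 by positivity)] with i hi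
    rw [Real.norm_of_nonneg (h.log_inv_pos i).le, Real.norm_of_nonneg (by linarith [h.one_le i]),
      ← (hs i).2] at hi
    have h1 := legendreRate.half_sq_le (hs i).1.le
    have hB : 0 < B i := by linarith [h.one_le i]
    rw [Real.dist_eq, sub_zero, abs_of_pos (hs i).1]
    have h2 : B i * (legendreRate (s i) / 2) ≤ B i * (e ^ 2 / 8) := by linarith
    have h3 := le_of_mul_le_mul_left h2 hB
    by_contra! h4
    nlinarith
  have h1 := tendsto_expNegDegree_div h.one_le h.pos h.lt_one (fun i => (hs i).1)
    (fun i => (hs i).2) htop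
  have h2 := h1.mul (legendreRate.tendsto_sinh_div_sqrt.comp hs0)
  rw [one_mul] at h2
  refine isEquivalent_of_tendsto_one (h2.congr fun i => ?_)
  have h3 := h.one_le i
  have h4 := legendreRate.pos (hs i).1
  have h5 := Real.sinh_pos_iff.2 (hs i).1
  have h6 : √(B i * Real.log (δ i)⁻¹) = B i / 2 * √(2 * legendreRate (s i)) := by
    rw [← (hs i).2, show B i * (B i / 2 * legendreRate (s i)) =
      (B i / 2) ^ 2 * (2 * legendreRate (s i)) by ring,
      Real.sqrt_mul (by positivity), Real.sqrt_sq (by positivity)]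
  simp only [Function.comp_apply, Pi.div_apply]
  rw [h6]
  have : 0 < √(2 * legendreRate (s i)) := Real.sqrt_pos.2 (by positivity)
  field_simp

/-- The tilt is constant because z = rL, so D = rL sinh s. -/
theorem tendsto_of_eq_mul_log (h : IsParamFamily l B δ) {r s : ℝ} (hr : 0 < r) (hs : 0 < s)
    (hsr : legendreRate s = r⁻¹) (hB : ∀ i, B i = 2 * r * Real.log (δ i)⁻¹) :
    Tendsto (fun i => expNegDegree (B i) (δ i) / Real.log (δ i)⁻¹) l (𝓝 (Real.sinh s * r)) := by
  have htop : Tendsto (fun i => Real.log (δ i)⁻¹) l atTop :=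
    h.tendsto_log_of_le (fun x => 2 * r * x) (monotone_mul_left_of_nonneg (by positivity))
      (Eventually.of_forall fun i => (hB i).le)
  have h1 := tendsto_expNegDegree_div h.one_le h.pos h.lt_one (fun _ => hs)
    (fun i => by rw [hB i, hsr]; field_simp) htop
  have h2 := h1.mul_const (Real.sinh s * r)
  rw [one_mul] at h2
  refine h2.congr fun i => ?_
  have h3 := h.log_inv_pos i
  have h5 := Real.sinh_pos_iff.2 hs
  rw [hB i]
  field_simp

end IsParamFamily

theorem exists_rateG_eq {r : ℝ} (hr : 0 < r) : ∃ s : ℝ, 0 < s ∧ legendreRate s = r⁻¹ ∧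
    rateG (Real.sinh s) = 1 - r⁻¹ ∧
    ∀ ν : ℝ, 0 < ν → rateG ν = 1 - r⁻¹ → ν = Real.sinh s := by
  obtain ⟨s, hs, h⟩ := legendreRate.exists_eq (inv_pos.2 hr)
  refine ⟨s, hs, h, by rw [rateG_eq, Real.arsinh_sinh, h], fun ν hν hG => ?_⟩
  rw [rateG_eq] at hG
  have h1 : legendreRate (Real.arsinh ν) = legendreRate s := by linarith
  have h2 := legendreRate.strictMonoOn.injOn (Real.arsinh_nonneg_iff.2 hν.le) hs.le h1
  rw [← h2, Real.sinh_arsinh]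

theorem theorem1 :
    -- order of magnitude, for all parameters; the constants depend only on `δ₀ < 1/2`
    (∀ δ₀ : ℝ, δ₀ < 1 / 2 → ∃ c C : ℝ, 0 < c ∧ 0 < C ∧
      ∀ B δ : ℝ, 1 ≤ B → 0 < δ → δ ≤ δ₀ →
        c * max (Real.sqrt (B * Real.log δ⁻¹))
            (Real.log δ⁻¹ / Real.log (max 2 (B⁻¹ * Real.log δ⁻¹))) ≤ expNegDegree B δ ∧
        expNegDegree B δ ≤ C * max (Real.sqrt (B * Real.log δ⁻¹))
            (Real.log δ⁻¹ / Real.log (max 2 (B⁻¹ * Real.log δ⁻¹)))) ∧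
    -- the same without the truncation `max 2`, when `B⁻¹ log δ⁻¹` is not in `[1, ρ)`
    (∀ δ₀ ρ : ℝ, δ₀ < 1 / 2 → 1 < ρ → ∃ c C : ℝ, 0 < c ∧ 0 < C ∧
      ∀ B δ : ℝ, 1 ≤ B → 0 < δ → δ ≤ δ₀ →
        (B⁻¹ * Real.log δ⁻¹ < 1 ∨ ρ ≤ B⁻¹ * Real.log δ⁻¹) →
        c * max (Real.sqrt (B * Real.log δ⁻¹))
            (Real.log δ⁻¹ / Real.log (B⁻¹ * Real.log δ⁻¹)) ≤ expNegDegree B δ ∧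
        expNegDegree B δ ≤ C * max (Real.sqrt (B * Real.log δ⁻¹))
            (Real.log δ⁻¹ / Real.log (B⁻¹ * Real.log δ⁻¹))) ∧
    -- `B = o(log δ⁻¹)`
    (∀ (ι : Type u) (l : Filter ι) (B δ : ι → ℝ), IsParamFamily l B δ →
      B =o[l] (fun i => Real.log (δ i)⁻¹) →
      (fun i => expNegDegree (B i) (δ i)) ~[l]
        (fun i => Real.log (δ i)⁻¹ / Real.log ((B i)⁻¹ * Real.log (δ i)⁻¹))) ∧
    -- `B = 2 r log δ⁻¹` for fixed `r > 0`
    (∀ r : ℝ, 0 < r → ∃ ν : ℝ, 0 < ν ∧ rateG ν = 1 - r⁻¹ ∧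
      (∀ ν' : ℝ, 0 < ν' → rateG ν' = 1 - r⁻¹ → ν' = ν) ∧
      ∀ (ι : Type u) (l : Filter ι) (B δ : ι → ℝ), IsParamFamily l B δ →
        (∀ i, B i = 2 * r * Real.log (δ i)⁻¹) →
        Tendsto (fun i => expNegDegree (B i) (δ i) / Real.log (δ i)⁻¹) l (𝓝 (ν * r))) ∧
    -- `B = ω(log δ⁻¹)` and `B ≤ δ ^ (-o(1))`
    (∀ (ι : Type u) (l : Filter ι) (B δ : ι → ℝ), IsParamFamily l B δ →
      (fun i => Real.log (δ i)⁻¹) =o[l] B →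
      (∃ ε : ι → ℝ, Tendsto ε l (𝓝 0) ∧ ∀ᶠ i in l, B i ≤ (δ i) ^ (-(ε i))) →
      (fun i => expNegDegree (B i) (δ i)) ~[l]
        (fun i => Real.sqrt (B i * Real.log (δ i)⁻¹))) ∧
    -- `B ≥ δ ^ (-Ω(1))`
    (∀ δ₀ : ℝ, δ₀ < 1 / 2 → ∃ c C : ℝ, 0 < c ∧ 0 < C ∧ ∀ a : ℝ, 0 < a →
      ∃ K : ℝ, ∀ B δ : ℝ, 1 ≤ B → 0 < δ → δ ≤ δ₀ → K ≤ B + δ⁻¹ → δ ^ (-a) ≤ B →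
        c * Real.sqrt (B * Real.log δ⁻¹) ≤ expNegDegree B δ ∧
        expNegDegree B δ ≤ C * Real.sqrt (B * Real.log δ⁻¹)) := by
  refine ⟨fun δ₀ hδ₀ => ?_, fun δ₀ ρ hδ₀ hρ => ?_, fun ι l B δ h ho => ?_, fun r hr => ?_,
    fun ι l B δ h ho hε => ?_, fun δ₀ hδ₀ => ?_⟩
  · obtain ⟨c, hc, h⟩ := exists_degreeOrder_le hδ₀
    exact ⟨c, 20, hc, by norm_num, fun B δ hB hδ hδδ => ⟨h B δ hB hδ hδδ,
      expNegDegree_le_degreeOrder hB hδ (hδδ.trans_lt hδ₀)⟩⟩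
  · obtain ⟨c, hc, h⟩ := exists_degreeOrder_le hδ₀
    have hK : 0 < max 1 (Real.log 2 / Real.log ρ) := by positivity
    refine ⟨c / max 1 (Real.log 2 / Real.log ρ), 40, by positivity, by norm_num,
      fun B δ hB hδ hδδ hv => ?_⟩
    have hL := (Real.log_pos one_lt_two).trans (log_two_lt_log_inv hδ (hδδ.trans_lt hδ₀))
    obtain ⟨h1, h2⟩ := degreeOrder_untruncated (by linarith) hL hρ hv
    have h3 := h B δ hB hδ hδδ
    have h4 := expNegDegree_le_degreeOrder hB hδ (hδδ.trans_lt hδ₀)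
    refine ⟨?_, by linarith⟩
    rw [div_mul_eq_mul_div, div_le_iff₀ hK]
    have h5 := mul_le_mul_of_nonneg_left h2 hc.le
    have h6 := mul_le_mul_of_nonneg_right h3 hK.le
    linarith
  · exact h.isEquivalent_of_isLittleO_log ho
  · obtain ⟨s, hs, hsr, hG, huniq⟩ := exists_rateG_eq hr
    exact ⟨Real.sinh s, Real.sinh_pos_iff.2 hs, hG, huniq,
      fun ι l B δ h hB => h.tendsto_of_eq_mul_log hr hs hsr hB⟩
  · exact h.isEquivalent_of_log_isLittleO ho hε
  · obtain ⟨c, hc, h⟩ := exists_degreeOrder_le hδ₀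
    refine ⟨c, 40, hc, by norm_num, fun a ha => ⟨2 / a ^ 2 + Real.exp (2 / a ^ 2),
      fun B δ hB hδ hδδ hK hBa => ?_⟩⟩
    have hL := (Real.log_pos one_lt_two).trans (log_two_lt_log_inv hδ (hδδ.trans_lt hδ₀))
    -- Only L ≤ B matters from here: the square-root entry then dominates the order up to a factor
    -- 2.
    have hLB := log_inv_le_of_rpow_le hδ (by linarith) ha hK hBa
    have h1 : √(B * Real.log δ⁻¹) ≤ degreeOrder B (Real.log δ⁻¹) := le_max_left _ _
    have h2 := degreeOrder.le_two_mul_sqrt hL.le hLB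
    have h3 := mul_le_mul_of_nonneg_left h1 hc.le
    exact ⟨h3.trans (h B δ hB hδ hδδ), by
      linarith [expNegDegree_le_degreeOrder hB hδ (hδδ.trans_lt hδ₀)]⟩
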